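/- Let $n\ge 2$, let $n-1<p\le n$ (if $n=2$, the value $p=1$ is also allowed, so $1\le p\le 2$), and let $\Omega\subset\mathbb R^n$ be a domain (a non-empty connected open set, not necessarily bounded) whose boundary has positive $p$-capacity, $\operatorname{cap}_p(\partial\Omega)>0$. Here, for a set $A\subset\mathbb R^n$, $$\operatorname{cap}_p(A)=\inf_u\ \int_{\mathbb R^n}|u|^p\,dx+\int_{\mathbb R^n}|\nabla u|^p\,dx ,$$ where the infimum is over all $u\in W^1_p(\mathbb R^n)$ with $u\ge 1$ almost everywhere on an open neighbourhood of $A$ (the Sobolev $p$-capacity). For a compact set $F\subset\Omega$ put $$\operatorname{cap}_p(F;\Omega)=\inf_f \int_\Omega|\nabla f|^p\,dx ,$$ where the infimum is over all continuous functions $f:\Omega\to\mathbb R$ with compact support in $\Omega$ and weak gradient $\nabla f\in L_p(\Omega)$ such that $f\ge 1$ on $F$. For $x,y\in\Omega$ let $$d_p(x,y)=\inf_\gamma\ \operatorname{cap}_p^{1/p}(\gamma;\Omega),$$ where the infimum is over all continuous curves $\gamma$ in $\Omega$ joining $x$ and $y$, each curve being identified with its image. Then $d_p$ is a metric on $\Omega$: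 it is finite, $d_p(x,y)=0$ if and only if $x=y$, it is symmetric, and it satisfies the triangle inequality. -/

import Mathlib

open MeasureTheory
open scoped ENNReal ContDiff

/-- `g` is the weak gradient on the open set `Ω ⊆ ℝⁿ` of the function `f`: both are locally
integrable on `Ω` and `∫_Ω f ∂_i φ = - ∫_Ω g_i φ` for all test functions `φ ∈ C_c^∞(Ω)` and all
coordinates `i`. -/
structure IsWeakGradient {n : ℕ} (Ω : Set (EuclideanSpace ℝ (Fin n)))
    (f : EuclideanSpace ℝ (Fin n) → ℝ)
    (g : EuclideanSpace ℝ (Fin n) → EuclideanSpace ℝ (Fin n)) : Prop where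
  locallyIntegrableOn : LocallyIntegrableOn f Ω
  locallyIntegrableOn_grad : LocallyIntegrableOn g Ω
  integral_eq : ∀ φ : EuclideanSpace ℝ (Fin n) → ℝ, ContDiff ℝ ∞ φ → HasCompactSupport φ →
    tsupport φ ⊆ Ω → ∀ i : Fin n,
      ∫ x in Ω, f x * fderiv ℝ φ x (EuclideanSpace.single i 1) = - ∫ x in Ω, g x i * φ x

/-- `f` belongs to the homogeneous Sobolev space `L¹_p(Ω)`, with weak gradient `g ∈ L_p(Ω)`. -/
structure MemHomSobolev {n : ℕ} (p : ℝ) (Ω : Set (EuclideanSpace ℝ (Fin n)))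
    (f : EuclideanSpace ℝ (Fin n) → ℝ)
    (g : EuclideanSpace ℝ (Fin n) → EuclideanSpace ℝ (Fin n)) : Prop where
  isWeakGradient : IsWeakGradient Ω f g
  memLp_grad : MemLp g (ENNReal.ofReal p) (volume.restrict Ω)

/-- `f` is an admissible function for the condenser `(F; G)`, with weak gradient `g`: `f` is a
continuous function in `L¹_p(G)` with compact support in `G`, and `f ≥ 1` on `F`. Such a function is
identified with its extension by zero to `ℝⁿ`. -/
structure IsAdmissible {n : ℕ} (p : ℝ) (F G : Set (EuclideanSpace ℝ (Fin n)))
    (f : EuclideanSpace ℝ (Fin n) → ℝ)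
    (g : EuclideanSpace ℝ (Fin n) → EuclideanSpace ℝ (Fin n)) : Prop where
  continuous : Continuous f
  hasCompactSupport : HasCompactSupport f
  tsupport_subset : tsupport f ⊆ G
  memHomSobolev : MemHomSobolev p G f g
  one_le : ∀ x ∈ F, 1 ≤ f x

/-- The `p`-capacity `cap_p(F; G) = inf ‖∇f‖_{L_p(G)}^p` of the condenser `(F; G)`, the infimum
being taken over all admissible functions. -/
noncomputable def condenserCapacity {n : ℕ} (p : ℝ) (F G : Set (EuclideanSpace ℝ (Fin n))) :
    ℝ≥0∞ :=
  ⨅ (f : EuclideanSpace ℝ (Fin n) → ℝ)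
    (g : EuclideanSpace ℝ (Fin n) → EuclideanSpace ℝ (Fin n)) (_ : IsAdmissible p F G f g),
    eLpNorm g (ENNReal.ofReal p) (volume.restrict G) ^ p

/-- The `p`-capacity of an arbitrary set `A ⊆ ℝⁿ` (Sobolev capacity, an outer measure on `ℝⁿ`): the
infimum of `∫ |u|^p + ∫ |∇u|^p` over all `u ∈ W¹_p(ℝⁿ)` with `u ≥ 1` almost everywhere on an open
neighbourhood of `A`. -/
noncomputable def sobolevCapacity {n : ℕ} (p : ℝ) (A : Set (EuclideanSpace ℝ (Fin n))) : ℝ≥0∞ :=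
  ⨅ (u : EuclideanSpace ℝ (Fin n) → ℝ)
    (g : EuclideanSpace ℝ (Fin n) → EuclideanSpace ℝ (Fin n))
    (_ : MemLp u (ENNReal.ofReal p) volume ∧ MemHomSobolev p Set.univ u g ∧
      ∃ U : Set (EuclideanSpace ℝ (Fin n)), IsOpen U ∧ A ⊆ U ∧ ∀ᵐ x ∂volume.restrict U, 1 ≤ u x),
    eLpNorm u (ENNReal.ofReal p) volume ^ p + eLpNorm g (ENNReal.ofReal p) volume ^ p

/-- `d_p(x, y) = inf_γ cap_p^{1/p}(γ; Ω)`, the infimum being taken over all continuous curves `γ` in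
`Ω` joining `x` and `y`; the curve enters the capacity through its image. -/
noncomputable def capacitaryDist {n : ℕ} (p : ℝ) (Ω : Set (EuclideanSpace ℝ (Fin n))) (x y : Ω) :
    ℝ≥0∞ :=
  ⨅ γ : Path x y, condenserCapacity p (Subtype.val '' Set.range γ) Ω ^ (1 / p)

/-!
The infimum defining the condenser capacity may be restricted to nonnegative functions in `C_c^∞`
(`exists_smoothAdmissible_of_condenserCapacity_lt`): mollification does not increase the energy,
because the gradient of a mollification is an average of the weak gradient. Nonnegative competitors
add up, which gives the triangle inequality; a cutoff gives finiteness; and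
`capacitaryDist_self` holds because points have zero `p`-capacity for `p ≤ n` and `n ≥ 2`.

The substance is that `d_p(x, y) = 0` forces `x = y`. For `n = 2` and `p = 1`, if `x i ≠ y i`, every
line orthogonal to the `i`-th axis over the interval between these coordinates meets the curve, so
Fubini bounds the energy from below (`ofReal_abs_sub_le_eLpNorm_one_fderiv`).

For `p > n - 1`, suppose that `f ∈ C_c^∞(Ω)` is at least `1` on a curve from `x` to `y` and has
small energy. By a Vitali covering argument, some point `z` of the curve near `x` has the property
that the energy of `f` in every ball of radius `ρ ≤ R` about `z` is at most a small multiple of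
`ρ` (`IsPreconnected.ofReal_le_lintegral_of_forall_closedBall`). Since `p > n - 1`, a Morrey type
estimate shows that `f z ≥ 1` is close to the mean of `f` over the ball of radius `R`
(`exists_abs_sub_setAverage_le_of_lintegral_closedBall_le`). By the Poincaré inequality `f` is
then close in `L^p` of a large ball to a constant `a ≥ 1 / 2` (`exists_eLpNorm_sub_const_le`). Now
`1 - f / a` is equal to `1` near `∂Ω`, is small in `L^p` of the ball and has small energy. Gluing
such functions over an exhaustion by balls (`sobolevCapacity_eq_zero_of_forall_exists`) shows that
`∂Ω` has zero capacity, contrary to the hypothesis.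
-/

open Filter Topology Set Metric

/-! ### Smooth admissible functions -/

/-- A smooth competitor for the condenser `(F; G)`: a nonnegative function in `C_c^∞(G)` that is at
least `1` on `F`. -/
structure SmoothAdmissible {E : Type*} [NormedAddCommGroup E] [NormedSpace ℝ E] (F G : Set E)
    (φ : E → ℝ) : Prop where
  contDiff : ContDiff ℝ ∞ φ
  hasCompactSupport : HasCompactSupport φ
  tsupport_subset : tsupport φ ⊆ G
  nonneg : ∀ x, 0 ≤ φ x
  one_le : ∀ x ∈ F, 1 ≤ φ x

theorem norm_gradient_eq {E : Type*} [NormedAddCommGroup E] [InnerProductSpace ℝ E]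
    [CompleteSpace E] (f : E → ℝ) (x : E) : ‖gradient f x‖ = ‖fderiv ℝ f x‖ := by
  simp [gradient]

theorem gradient_apply_single {n : ℕ} (f : EuclideanSpace ℝ (Fin n) → ℝ)
    (x : EuclideanSpace ℝ (Fin n)) (i : Fin n) :
    gradient f x i = fderiv ℝ f x (EuclideanSpace.single i 1) := by
  have h := InnerProductSpace.toDual_symm_apply (𝕜 := ℝ) (x := EuclideanSpace.single i (1 : ℝ))
    (y := fderiv ℝ f x)
  rw [← h, EuclideanSpace.inner_single_right]
  simp [gradient]

theorem continuous_gradient {n : ℕ} {f : EuclideanSpace ℝ (Fin n) → ℝ} (hf : ContDiff ℝ ∞ f) :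
    Continuous (gradient f) :=
  (LinearIsometryEquiv.continuous _).comp (hf.continuous_fderiv (by simp))

theorem isWeakGradient_gradient {n : ℕ} {f : EuclideanSpace ℝ (Fin n) → ℝ} (hf : ContDiff ℝ ∞ f)
    (G : Set (EuclideanSpace ℝ (Fin n))) : IsWeakGradient G f (gradient f) := by
  refine ⟨hf.continuous.locallyIntegrable.locallyIntegrableOn _,
    (continuous_gradient hf).locallyIntegrable.locallyIntegrableOn _, fun φ hφ hφc hφG i => ?_⟩
  have hf' : Continuous fun x => fderiv ℝ f x (EuclideanSpace.single i 1) :=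
    (hf.continuous_fderiv (by simp)).clm_apply continuous_const
  have hφ' : Continuous fun x => fderiv ℝ φ x (EuclideanSpace.single i 1) :=
    (hφ.continuous_fderiv (by simp)).clm_apply continuous_const
  have hφ'c : HasCompactSupport fun x => fderiv ℝ φ x (EuclideanSpace.single i 1) :=
    hφc.fderiv_apply ℝ _
  rw [setIntegral_eq_integral_of_forall_compl_eq_zero,
    setIntegral_eq_integral_of_forall_compl_eq_zero]
  · simp_rw [gradient_apply_single]
    exact integral_mul_fderiv_eq_neg_fderiv_mul_of_integrable
      ((hf'.mul hφ.continuous).integrable_of_hasCompactSupport hφc.mul_left)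
      ((hf.continuous.mul hφ').integrable_of_hasCompactSupport hφ'c.mul_left)
      ((hf.continuous.mul hφ.continuous).integrable_of_hasCompactSupport hφc.mul_left)
      (fun x _ => (hf.differentiable (by simp)) x) (fun x _ => (hφ.differentiable (by simp)) x)
  · intro x hx
    rw [image_eq_zero_of_notMem_tsupport fun h => hx (hφG h), mul_zero]
  · intro x hx
    rw [fderiv_of_notMem_tsupport ℝ fun h => hx (hφG h)]
    simp

theorem eLpNorm_gradient {n : ℕ} (f : EuclideanSpace ℝ (Fin n) → ℝ) (q : ℝ≥0∞)
    (μ : Measure (EuclideanSpace ℝ (Fin n))) :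
    eLpNorm (gradient f) q μ = eLpNorm (fderiv ℝ f) q μ :=
  eLpNorm_congr_norm_ae (ae_of_all _ fun x => norm_gradient_eq f x)

theorem SmoothAdmissible.condenserCapacity_rpow_le {n : ℕ} {p : ℝ} (hp : 1 ≤ p)
    {F G : Set (EuclideanSpace ℝ (Fin n))} {φ : EuclideanSpace ℝ (Fin n) → ℝ}
    (h : SmoothAdmissible F G φ) :
    condenserCapacity p F G ^ (1 / p) ≤ eLpNorm (fderiv ℝ φ) (ENNReal.ofReal p) volume := by
  have hc : Continuous (gradient φ) := continuous_gradient h.contDiff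
  have hcs : HasCompactSupport (gradient φ) :=
    (h.hasCompactSupport.fderiv ℝ).comp_left (map_zero _)
  have hadm : IsAdmissible p F G φ (gradient φ) :=
    ⟨h.contDiff.continuous, h.hasCompactSupport, h.tsupport_subset,
      ⟨isWeakGradient_gradient h.contDiff G, (hc.memLp_of_hasCompactSupport hcs).restrict _⟩,
      h.one_le⟩
  calc condenserCapacity p F G ^ (1 / p)
      ≤ (eLpNorm (gradient φ) (ENNReal.ofReal p) (volume.restrict G) ^ p) ^ (1 / p) := by
        gcongr
        exact iInf_le_of_le φ (iInf_le_of_le _ (iInf_le _ hadm))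
    _ = eLpNorm (gradient φ) (ENNReal.ofReal p) (volume.restrict G) := by
        rw [← ENNReal.rpow_mul, mul_one_div_cancel (by linarith), ENNReal.rpow_one]
    _ ≤ eLpNorm (gradient φ) (ENNReal.ofReal p) volume :=
        eLpNorm_mono_measure _ Measure.restrict_le_self
    _ = _ := eLpNorm_gradient _ _ _

/-! ### Mollification -/

/-- Jensen's inequality for the power function, for a finite measure that need not be
normalized. -/
theorem lintegral_rpow_le_measure_univ_rpow_mul {α : Type*} [MeasurableSpace α] {μ : Measure α}
    {p : ℝ} (hp : 1 ≤ p) {f : α → ℝ≥0∞} (hf : AEMeasurable f μ) :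
    (∫⁻ x, f x ∂μ) ^ p ≤ μ univ ^ (p - 1) * ∫⁻ x, f x ^ p ∂μ := by
  rcases hp.eq_or_lt with rfl | hp
  · simp
  have hpq := Real.HolderConjugate.conjExponent hp
  have h := ENNReal.lintegral_mul_le_Lp_mul_Lq μ hpq hf (aemeasurable_const (b := (1 : ℝ≥0∞)))
  simp only [Pi.mul_apply, mul_one, ENNReal.one_rpow, lintegral_const, one_mul] at h
  calc (∫⁻ x, f x ∂μ) ^ p
      ≤ ((∫⁻ x, f x ^ p ∂μ) ^ (1 / p) * μ univ ^ (1 / p.conjExponent)) ^ p := by gcongr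
    _ = _ := by
      rw [ENNReal.mul_rpow_of_nonneg _ _ (by linarith), ← ENNReal.rpow_mul, ← ENNReal.rpow_mul,
        one_div_mul_cancel (by linarith), ENNReal.rpow_one, mul_comm]
      congr 2
      have : p - 1 ≠ 0 := by linarith
      unfold Real.conjExponent
      field_simp

/-- Averaging against a probability density is a contraction of `L^p`. -/
theorem lintegral_rpow_lintegral_sub_le {E : Type*} [NormedAddCommGroup E] [NormedSpace ℝ E]
    [FiniteDimensional ℝ E] [MeasurableSpace E] [BorelSpace E] {μ ν : Measure E}
    [μ.IsAddHaarMeasure] [SFinite ν] (hν : ν ≤ μ) {p : ℝ} (hp : 1 ≤ p) {η k : E → ℝ≥0∞}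
    (hη : Measurable η) (hη1 : ∫⁻ x, η x ∂μ ≤ 1) (hk : AEMeasurable k ν) :
    ∫⁻ x, (∫⁻ y, η (x - y) * k y ∂ν) ^ p ∂μ ≤ ∫⁻ y, k y ^ p ∂ν := by
  wlog hkm : Measurable k generalizing k
  · have h1 : ∀ x, ∫⁻ y, η (x - y) * k y ∂ν = ∫⁻ y, η (x - y) * hk.mk k y ∂ν := fun x =>
      lintegral_congr_ae (by filter_upwards [hk.ae_eq_mk] with y hy; rw [hy])
    have h2 : ∫⁻ y, k y ^ p ∂ν = ∫⁻ y, hk.mk k y ^ p ∂ν :=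
      lintegral_congr_ae (by filter_upwards [hk.ae_eq_mk] with y hy; rw [hy])
    simp_rw [h1, h2]
    exact this hk.measurable_mk.aemeasurable hk.measurable_mk
  have hmeas : Measurable fun z : E × E => η (z.1 - z.2) := hη.comp (by fun_prop)
  have hpt : ∀ x, (∫⁻ y, η (x - y) * k y ∂ν) ^ p ≤ ∫⁻ y, η (x - y) * k y ^ p ∂ν := by
    intro x
    have hmx : Measurable fun y => η (x - y) := hη.comp (by fun_prop)
    have h := lintegral_rpow_le_measure_univ_rpow_mul (μ := ν.withDensity fun y => η (x - y)) hp
      hkm.aemeasurable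
    rw [lintegral_withDensity_eq_lintegral_mul _ hmx hkm,
      lintegral_withDensity_eq_lintegral_mul _ hmx (hkm.pow_const p)] at h
    refine h.trans (mul_le_of_le_one_left zero_le ?_)
    refine ENNReal.rpow_le_one ?_ (by linarith)
    rw [withDensity_apply _ MeasurableSet.univ, Measure.restrict_univ]
    calc ∫⁻ y, η (x - y) ∂ν ≤ ∫⁻ y, η (x - y) ∂μ := lintegral_mono' hν le_rfl
      _ = ∫⁻ y, η y ∂μ := lintegral_sub_left_eq_self η x
      _ ≤ 1 := hη1
  calc ∫⁻ x, (∫⁻ y, η (x - y) * k y ∂ν) ^ p ∂μ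
      ≤ ∫⁻ x, ∫⁻ y, η (x - y) * k y ^ p ∂ν ∂μ := lintegral_mono hpt
    _ = ∫⁻ y, ∫⁻ x, η (x - y) * k y ^ p ∂μ ∂ν := by
        refine lintegral_lintegral_swap (Measurable.aemeasurable ?_)
        exact hmeas.mul ((hkm.comp measurable_snd).pow_const p)
    _ ≤ ∫⁻ y, k y ^ p ∂ν := by
        refine lintegral_mono fun y => ?_
        have hmy : Measurable fun x => η (x - y) := hη.comp (by fun_prop)
        rw [lintegral_mul_const _ hmy, lintegral_sub_right_eq_self η y]
        exact mul_le_of_le_one_left zero_le hη1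

theorem IsCompact.exists_contDiff_cutoff {E : Type*} [NormedAddCommGroup E] [NormedSpace ℝ E]
    [FiniteDimensional ℝ E] {K G : Set E} (hK : IsCompact K) (hG : IsOpen G) (hKG : K ⊆ G) :
    ∃ χ : E → ℝ, ContDiff ℝ ∞ χ ∧ HasCompactSupport χ ∧ tsupport χ ⊆ G ∧
      (∀ᶠ x in 𝓝ˢ K, χ x = 1) ∧ ∀ x, χ x ∈ Icc (0 : ℝ) 1 := by
  obtain ⟨L, hL, hKL, hLG⟩ := exists_compact_between hK hG hKG
  obtain ⟨f, hf1, hf0, hf⟩ := exists_contMDiffMap_one_nhds_of_subset_interior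
    (modelWithCornersSelf ℝ E) (n := (⊤ : ℕ∞)) hK.isClosed hKL
  have hsub : tsupport f ⊆ L := closure_minimal
    (fun x hx => by_contra fun h => hx (hf0 x h)) hL.isClosed
  exact ⟨f, f.contMDiff.contDiff, hL.of_isClosed_subset (isClosed_tsupport _) hsub,
    hsub.trans hLG, hf1, hf⟩

/-- The gradient of a mollification is an average of the weak gradient. The weak gradient lives on
`G` only, so it is paired with a cutoff `χ` that is `1` near the support of `f`. -/
theorem IsAdmissible.gradient_convolution_eq {n : ℕ} {p : ℝ} (hp : 1 ≤ p)
    {F G : Set (EuclideanSpace ℝ (Fin n))} {f : EuclideanSpace ℝ (Fin n) → ℝ}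
    {g : EuclideanSpace ℝ (Fin n) → EuclideanSpace ℝ (Fin n)}
    (h : IsAdmissible p F G f g) {η χ : EuclideanSpace ℝ (Fin n) → ℝ}
    (hη : ContDiff ℝ ∞ η) (hηc : HasCompactSupport η) (hχ : ContDiff ℝ ∞ χ)
    (hχc : HasCompactSupport χ) (hχG : tsupport χ ⊆ G) (hχ1 : ∀ᶠ x in 𝓝ˢ (tsupport f), χ x = 1)
    (x : EuclideanSpace ℝ (Fin n)) :
    gradient (convolution η f (ContinuousLinearMap.lsmul ℝ ℝ) volume) x =
      ∫ y in G, (η (x - y) * χ y) • g y := by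
  have hfl : LocallyIntegrable f volume := h.continuous.locallyIntegrable
  have hder : ∀ v, fderiv ℝ (convolution η f (ContinuousLinearMap.lsmul ℝ ℝ) volume) x v =
      ∫ y, f y * fderiv ℝ η (x - y) v := by
    intro v
    have h1 := hηc.hasFDerivAt_convolution_right (ContinuousLinearMap.lsmul ℝ ℝ).flip
      hfl (hη.of_le (by simp)) x
    rw [convolution_flip] at h1
    rw [h1.fderiv, convolution_precompR_apply _ hfl (hηc.fderiv ℝ) (hη.continuous_fderiv (by simp))]
    simp [convolution, mul_comm]
  have hψ : ContDiff ℝ ∞ fun y => η (x - y) * χ y :=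
    (hη.comp (contDiff_const.sub contDiff_id)).mul hχ
  have hψc : HasCompactSupport fun y => η (x - y) * χ y := hχc.mul_left
  have hψG : (tsupport fun y => η (x - y) * χ y) ⊆ G :=
    (tsupport_mul_subset_right (f := fun y => η (x - y))).trans hχG
  have hgl : LocallyIntegrable g (volume.restrict G) :=
    h.memHomSobolev.memLp_grad.locallyIntegrable (by simpa using hp)
  have hint : Integrable (fun y => (η (x - y) * χ y) • g y) (volume.restrict G) :=
    hgl.integrable_smul_left_of_hasCompactSupport hψ.continuous hψc
  ext i
  rw [gradient_apply_single, hder]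
  have h2 := h.memHomSobolev.isWeakGradient.integral_eq _ hψ hψc hψG i
  have h3 : ∀ y, f y * fderiv ℝ (fun y => η (x - y) * χ y) y (EuclideanSpace.single i 1) =
      -(f y * fderiv ℝ η (x - y) (EuclideanSpace.single i 1)) := by
    intro y
    by_cases hy : y ∈ tsupport f
    · have h4 : χ =ᶠ[𝓝 y] fun _ => 1 := hχ1.filter_mono (nhds_le_nhdsSet hy)
      have h5 : (fun y => η (x - y) * χ y) =ᶠ[𝓝 y] fun y => η (x - y) := by
        filter_upwards [h4] with z hz
        rw [hz, mul_one]
      rw [h5.fderiv_eq]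
      have h6 : HasFDerivAt (fun y => η (x - y))
          ((fderiv ℝ η (x - y)).comp (-ContinuousLinearMap.id ℝ _)) y :=
        ((hη.differentiable (by simp)) (x - y)).hasFDerivAt.comp y
          ((hasFDerivAt_id y).const_sub x)
      rw [h6.fderiv]
      simp
    · simp [image_eq_zero_of_notMem_tsupport hy]
  have h7 : (∫ y in G, (η (x - y) * χ y) • g y) i = ∫ y in G, g y i * (η (x - y) * χ y) := by
    rw [← PiLp.proj_apply (𝕜 := ℝ) 2 _ i (∫ y in G, (η (x - y) * χ y) • g y),
      ← ContinuousLinearMap.integral_comp_comm _ hint]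
    simp [mul_comm]
  rw [h7, ← neg_inj, ← h2, setIntegral_eq_integral_of_forall_compl_eq_zero, ← integral_neg]
  · simp_rw [h3]
  · intro y hy
    rw [image_eq_zero_of_notMem_tsupport fun h' => hy (h.tsupport_subset h'), zero_mul]

/-- Mollification: an admissible function is a uniform limit of functions in `C_c^∞(G)` whose energy
is no larger. -/
theorem IsAdmissible.exists_contDiff_near {n : ℕ} {p : ℝ} (hp : 1 ≤ p)
    {F G : Set (EuclideanSpace ℝ (Fin n))} (hG : IsOpen G) {f : EuclideanSpace ℝ (Fin n) → ℝ}
    {g : EuclideanSpace ℝ (Fin n) → EuclideanSpace ℝ (Fin n)}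
    (h : IsAdmissible p F G f g) {ε : ℝ} (hε : 0 < ε) :
    ∃ φ : EuclideanSpace ℝ (Fin n) → ℝ, ContDiff ℝ ∞ φ ∧ HasCompactSupport φ ∧ tsupport φ ⊆ G ∧
      (∀ x, |φ x - f x| ≤ ε) ∧ eLpNorm (fderiv ℝ φ) (ENNReal.ofReal p) volume ≤
        eLpNorm g (ENNReal.ofReal p) (volume.restrict G) := by
  have hK : IsCompact (tsupport f) := h.hasCompactSupport
  obtain ⟨δ₁, hδ₁, hδG⟩ := hK.exists_cthickening_subset_open hG h.tsupport_subset
  obtain ⟨δ₂, hδ₂, hδf⟩ := Metric.uniformContinuous_iff.mp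
    (h.hasCompactSupport.uniformContinuous_of_continuous h.continuous) ε hε
  obtain ⟨χ, hχ, hχc, hχG, hχ1, hχ01⟩ := hK.exists_contDiff_cutoff hG h.tsupport_subset
  have hδ : 0 < min δ₁ δ₂ := lt_min hδ₁ hδ₂
  let b : ContDiffBump (0 : EuclideanSpace ℝ (Fin n)) :=
    ⟨min δ₁ δ₂ / 2, min δ₁ δ₂, half_pos hδ, half_lt_self hδ⟩
  set η := b.normed (volume : Measure (EuclideanSpace ℝ (Fin n))) with hηdef
  have hη : ContDiff ℝ ∞ η := b.contDiff_normed
  have hηc : HasCompactSupport η := b.hasCompactSupport_normed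
  have hφ : ContDiff ℝ ∞ (convolution η f (ContinuousLinearMap.lsmul ℝ ℝ) volume) :=
    hηc.contDiff_convolution_left _ hη h.continuous.locallyIntegrable
  have hsub : tsupport (convolution η f (ContinuousLinearMap.lsmul ℝ ℝ) volume) ⊆
      cthickening δ₁ (tsupport f) := by
    refine closure_minimal ?_ isClosed_cthickening
    refine (support_convolution_subset _).trans ?_
    rintro _ ⟨a, ha, c, hc, rfl⟩
    rw [hηdef, b.support_normed_eq, mem_ball_zero_iff] at ha
    refine mem_cthickening_of_dist_le _ c _ _ (subset_tsupport f hc) ?_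
    simpa using ha.le.trans (min_le_left _ _)
  refine ⟨_, hφ, hK.cthickening.of_isClosed_subset (isClosed_tsupport _) hsub, hsub.trans hδG,
    fun x => ?_, ?_⟩
  · refine b.dist_normed_convolution_le h.continuous.aestronglyMeasurable fun y hy => ?_
    exact (hδf ((mem_ball.mp hy).trans_le (min_le_right _ _))).le
  · have hp0 : 0 < p := by linarith
    rw [← eLpNorm_gradient, eLpNorm_eq_lintegral_rpow_enorm_toReal (by simpa using hp0)
      ENNReal.ofReal_ne_top, eLpNorm_eq_lintegral_rpow_enorm_toReal (by simpa using hp0)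
      ENNReal.ofReal_ne_top, ENNReal.toReal_ofReal hp0.le]
    gcongr ?_ ^ _
    have hηm : Measurable fun y => ENNReal.ofReal (η y) :=
      hη.continuous.measurable.ennreal_ofReal
    have hη1 : ∫⁻ y, ENNReal.ofReal (η y) ≤ 1 := by
      rw [← ofReal_integral_eq_lintegral_ofReal b.integrable_normed
        (ae_of_all _ b.nonneg_normed), b.integral_normed, ENNReal.ofReal_one]
    refine le_trans (lintegral_mono fun x => ?_) (lintegral_rpow_lintegral_sub_le
      Measure.restrict_le_self hp hηm hη1 h.memHomSobolev.memLp_grad.1.enorm)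
    gcongr
    rw [h.gradient_convolution_eq hp hη hηc hχ hχc hχG hχ1]
    refine (enorm_integral_le_lintegral_enorm _).trans (lintegral_mono fun y => ?_)
    rw [enorm_smul]
    gcongr
    rw [Real.enorm_eq_ofReal (mul_nonneg (b.nonneg_normed _) (hχ01 y).1)]
    exact ENNReal.ofReal_le_ofReal (mul_le_of_le_one_right (b.nonneg_normed _) (hχ01 y).2)

/-! ### Reduction of the capacity to smooth functions -/

/-- The smooth substitute `√(t² + ε²) - ε` for the absolute value turns a smooth function into a
nonnegative one without increasing its energy. -/
theorem exists_contDiff_nonneg_near_abs {E : Type*} [NormedAddCommGroup E] [NormedSpace ℝ E]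
    {φ : E → ℝ} (hφ : ContDiff ℝ ∞ φ) {ε : ℝ} (hε : 0 < ε) :
    ∃ ψ : E → ℝ, ContDiff ℝ ∞ ψ ∧ tsupport ψ ⊆ tsupport φ ∧ (∀ x, 0 ≤ ψ x) ∧
      (∀ x, |φ x| - ε ≤ ψ x) ∧ ∀ x, ‖fderiv ℝ ψ x‖ ≤ ‖fderiv ℝ φ x‖ := by
  have hpos : ∀ x, 0 < φ x ^ 2 + ε ^ 2 := fun x => by positivity
  have hs : ∀ x, |φ x| ≤ √(φ x ^ 2 + ε ^ 2) := fun x =>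
    Real.abs_le_sqrt (by nlinarith [sq_nonneg ε])
  refine ⟨fun x => √(φ x ^ 2 + ε ^ 2) - ε,
    (((hφ.pow 2).add contDiff_const).sqrt fun x => (hpos x).ne').sub contDiff_const, ?_,
    fun x => ?_, fun x => ?_, fun x => ?_⟩
  · refine closure_mono fun x hx => ?_
    contrapose! hx
    simp only [Function.mem_support, not_not] at hx ⊢
    simp [hx, Real.sqrt_sq hε.le]
  · rw [sub_nonneg]
    exact Real.le_sqrt_of_sq_le (by nlinarith [sq_nonneg (φ x)])
  · linarith [hs x]
  · have hd := ((hφ.differentiable (by simp)) x).hasFDerivAt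
    have h2 := (((hd.pow 2).add_const (ε ^ 2)).sqrt (hpos x).ne').sub_const ε
    rw [h2.fderiv]
    have hsp : 0 < √(φ x ^ 2 + ε ^ 2) := Real.sqrt_pos.mpr (hpos x)
    have : (1 / (2 * √(φ x ^ 2 + ε ^ 2))) • ((2 • φ x ^ (2 - 1)) • fderiv ℝ φ x) =
        (φ x / √(φ x ^ 2 + ε ^ 2)) • fderiv ℝ φ x := by
      rw [smul_smul]
      congr 1
      simp
      field_simp
    rw [this, norm_smul, Real.norm_eq_abs, abs_div, abs_of_pos hsp]
    exact mul_le_of_le_one_left (norm_nonneg _) ((div_le_one hsp).mpr (hs x))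

/-- The condenser capacity is the infimum of the energy over smooth admissible functions. -/
theorem exists_smoothAdmissible_of_condenserCapacity_lt {n : ℕ} {p : ℝ} (hp : 1 ≤ p)
    {F G : Set (EuclideanSpace ℝ (Fin n))} (hG : IsOpen G) {c : ℝ≥0∞}
    (hc : condenserCapacity p F G ^ (1 / p) < c) :
    ∃ φ, SmoothAdmissible F G φ ∧ eLpNorm (fderiv ℝ φ) (ENNReal.ofReal p) volume < c := by
  have hp0 : 0 < p := by linarith
  have hc' : condenserCapacity p F G < c ^ p := by
    have := ENNReal.rpow_lt_rpow hc hp0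
    rwa [← ENNReal.rpow_mul, one_div_mul_cancel hp0.ne', ENNReal.rpow_one] at this
  simp only [condenserCapacity, iInf_lt_iff] at hc'
  obtain ⟨f, g, h, hlt⟩ := hc'
  replace hlt : eLpNorm g (ENNReal.ofReal p) (volume.restrict G) < c :=
    (ENNReal.rpow_lt_rpow_iff hp0).mp hlt
  have hfin := h.memHomSobolev.memLp_grad.2
  set N := eLpNorm g (ENNReal.ofReal p) (volume.restrict G) with hN
  -- a factor `s > 1` by which the competitor may be multiplied
  obtain ⟨s, hs1, hsN⟩ : ∃ s : ℝ, 1 < s ∧ ENNReal.ofReal s * N < c := by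
    have ht : Tendsto (fun s : ℝ => ENNReal.ofReal s * N) (𝓝[>] 1)
        (𝓝 (ENNReal.ofReal 1 * N)) := by
      refine Tendsto.mono_left ?_ nhdsWithin_le_nhds
      exact ENNReal.Tendsto.mul_const (ENNReal.continuous_ofReal.tendsto 1) (Or.inr hfin.ne)
    rw [ENNReal.ofReal_one, one_mul] at ht
    obtain ⟨s, hs, hs1⟩ := ((ht.eventually_lt_const hlt).and self_mem_nhdsWithin).exists
    exact ⟨s, hs1, hs⟩
  have hs0 : 0 < s := by linarith
  -- mollification and the smoothed absolute value each lose `ε`, leaving at least `s⁻¹` on `F`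
  set ε := (1 - s⁻¹) / 2 with hεdef
  have hε : 0 < ε := half_pos (sub_pos.mpr (inv_lt_one_of_one_lt₀ hs1))
  obtain ⟨φ, hφ, hφc, hφG, hφf, hφN⟩ := h.exists_contDiff_near hp hG hε
  obtain ⟨ψ, hψ, hψφ, hψ0, hψε, hψN⟩ := exists_contDiff_nonneg_near_abs hφ hε
  have hψc : HasCompactSupport ψ := hφc.of_isClosed_subset (isClosed_tsupport _) hψφ
  have hsψ : tsupport (fun x => s * ψ x) ⊆ tsupport ψ :=
    tsupport_mul_subset_right (f := fun _ => s)
  refine ⟨fun x => s * ψ x, ⟨contDiff_const.mul hψ, hψc.mul_left, (hsψ.trans hψφ).trans hφG,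
    fun x => mul_nonneg hs0.le (hψ0 x), fun x hx => ?_⟩, ?_⟩
  · have h1 := h.one_le x hx
    have h2 := abs_le.mp (hφf x)
    have h3 := hψε x
    have h4 := le_abs_self (φ x)
    have h5 : s⁻¹ ≤ ψ x := by linarith
    calc 1 = s * s⁻¹ := (mul_inv_cancel₀ hs0.ne').symm
      _ ≤ s * ψ x := by gcongr
  · have hfd : fderiv ℝ (fun x => s * ψ x) = s • fderiv ℝ ψ := by
      ext x : 1
      exact fderiv_const_mul ((hψ.differentiable (by simp)) x) s
    rw [hfd, eLpNorm_const_smul (c := s) (f := fderiv ℝ ψ), Real.enorm_eq_ofReal hs0.le]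
    refine lt_of_le_of_lt ?_ hsN
    gcongr
    exact (eLpNorm_mono hψN).trans hφN

theorem IsCompact.exists_smoothAdmissible {E : Type*} [NormedAddCommGroup E] [NormedSpace ℝ E]
    [FiniteDimensional ℝ E] {K G : Set E} (hK : IsCompact K) (hG : IsOpen G) (hKG : K ⊆ G) :
    ∃ φ : E → ℝ, SmoothAdmissible K G φ := by
  obtain ⟨χ, hχ, hχc, hχG, hχ1, hχ01⟩ := hK.exists_contDiff_cutoff hG hKG
  exact ⟨χ, hχ, hχc, hχG, fun x => (hχ01 x).1,
    fun x hx => (hχ1.self_of_nhdsSet x hx).ge⟩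

theorem SmoothAdmissible.eLpNorm_fderiv_lt_top {E : Type*} [NormedAddCommGroup E]
    [NormedSpace ℝ E] [MeasurableSpace E] [BorelSpace E] {F G : Set E}
    {φ : E → ℝ} (h : SmoothAdmissible F G φ) (q : ℝ≥0∞) (μ : Measure E)
    [IsFiniteMeasureOnCompacts μ] : eLpNorm (fderiv ℝ φ) q μ < ⊤ :=
  ((h.contDiff.continuous_fderiv (by simp)).memLp_of_hasCompactSupport
    (h.hasCompactSupport.fderiv ℝ)).2

/-! ### Points have zero capacity -/

theorem lintegral_comp_smul_eq {E : Type*} [NormedAddCommGroup E] [NormedSpace ℝ E]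
    [FiniteDimensional ℝ E] [MeasurableSpace E] [BorelSpace E] (μ : Measure E)
    [μ.IsAddHaarMeasure] (f : E → ℝ≥0∞) {c : ℝ} (hc : 0 < c) :
    ∫⁻ x, f (c • x) ∂μ = ENNReal.ofReal (c ^ Module.finrank ℝ E)⁻¹ * ∫⁻ x, f x ∂μ := by
  have h := lintegral_map_equiv (μ := μ) f (Homeomorph.smulOfNeZero c hc.ne').toMeasurableEquiv
  have h2 := Measure.map_addHaar_smul μ hc.ne'
  rw [abs_of_pos (by positivity)] at h2
  calc ∫⁻ x, f (c • x) ∂μ = ∫⁻ x, f x ∂(Measure.map (c • ·) μ) := h.symm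
    _ = _ := by rw [h2, lintegral_smul_measure, smul_eq_mul]

theorem enorm_sum_rpow_le_of_forall_ne {ι F : Type*} [NormedAddCommGroup F] (s : Finset ι)
    (v : ι → F) (hv : ∀ i ∈ s, ∀ j ∈ s, v i ≠ 0 → v j ≠ 0 → i = j) {q : ℝ} (hq : 0 < q) :
    ‖∑ i ∈ s, v i‖ₑ ^ q ≤ ∑ i ∈ s, ‖v i‖ₑ ^ q := by
  by_cases h : ∃ i ∈ s, v i ≠ 0
  · obtain ⟨i, hi, hvi⟩ := h
    rw [Finset.sum_eq_single_of_mem i hi fun j hj hji =>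
      by_contra fun hvj => hji (hv j hj i hi hvj hvi)]
    exact Finset.single_le_sum (f := fun i => ‖v i‖ₑ ^ q) (fun _ _ => zero_le) hi
  · push Not at h
    rw [Finset.sum_eq_zero h, enorm_zero, ENNReal.zero_rpow_of_pos hq]
    exact zero_le

/-- In dimension `d ≥ 2` there are smooth functions equal to `1` at a point, supported in a given
ball around it, with arbitrarily small energy of exponent `d`. Such a function is an average of `N`
cutoffs at the scales `4⁻ʲ`: their energies agree by conformal invariance and their gradients have
disjoint supports, so the energy of the average is of order `N ^ (1 - d)`. -/
theorem exists_contDiff_eLpNorm_finrank_fderiv_le {E : Type*} [NormedAddCommGroup E]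
    [InnerProductSpace ℝ E] [FiniteDimensional ℝ E] [MeasurableSpace E] [BorelSpace E]
    (μ : Measure E) [μ.IsAddHaarMeasure] (hd : 2 ≤ Module.finrank ℝ E) (x : E) {r : ℝ} (hr : 0 < r)
    {ε : ℝ≥0∞} (hε : 0 < ε) :
    ∃ φ : E → ℝ, ContDiff ℝ ∞ φ ∧ tsupport φ ⊆ closedBall x (2 * r) ∧ (∀ z, 0 ≤ φ z) ∧ φ x = 1 ∧
      eLpNorm (fderiv ℝ φ) (Module.finrank ℝ E : ℝ≥0∞) μ < ε := by
  set d := Module.finrank ℝ E with hddef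
  have hd0 : (0 : ℝ) < d := by exact_mod_cast (by omega : 0 < d)
  let b : ContDiffBump (0 : E) := ⟨1, 2, one_pos, one_lt_two⟩
  have hb : ContDiff ℝ ∞ b := b.contDiff
  set A := ∫⁻ z, ‖fderiv ℝ b z‖ₑ ^ (d : ℝ) ∂μ with hA
  have hAfin : A < ⊤ := by
    have h1 : MemLp (fderiv ℝ b) (d : ℝ≥0∞) μ :=
      (hb.continuous_fderiv (by simp)).memLp_of_hasCompactSupport
        (b.hasCompactSupport.fderiv ℝ)
    have h2 := lintegral_rpow_enorm_lt_top_of_eLpNorm_lt_top (by simp; omega) (by simp) h1.2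
    simpa [hA] using h2
  have hb0 : ∀ z, fderiv ℝ b z ≠ 0 → 1 ≤ ‖z‖ ∧ ‖z‖ ≤ 2 := by
    intro z hz
    constructor
    · by_contra! hlt
      have h1 : (b : E → ℝ) =ᶠ[𝓝 z] fun _ => 1 :=
        b.eventuallyEq_one_of_mem_ball (by simpa using hlt)
      exact hz (by rw [h1.fderiv_eq]; simp)
    · by_contra! hlt
      refine hz (fderiv_of_notMem_tsupport ℝ ?_)
      rw [b.tsupport_eq]
      simpa using hlt
  let ρ : ℕ → ℝ := fun j => r * (1 / 4) ^ j
  have hρ : ∀ j, 0 < ρ j := fun j => by positivity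
  have hρle : ∀ j, ρ j ≤ r := fun j =>
    mul_le_of_le_one_right hr.le (pow_le_one₀ (by norm_num) (by norm_num))
  let η : ℕ → E → ℝ := fun j z => b ((ρ j)⁻¹ • (z - x))
  have hη : ∀ j, ContDiff ℝ ∞ (η j) := fun j =>
    hb.comp ((contDiff_id.sub contDiff_const).const_smul _)
  have hηd : ∀ j z, fderiv ℝ (η j) z = (ρ j)⁻¹ • fderiv ℝ b ((ρ j)⁻¹ • (z - x)) := by
    intro j z
    have h1 : HasFDerivAt (fun z => (ρ j)⁻¹ • (z - x)) ((ρ j)⁻¹ • ContinuousLinearMap.id ℝ E) z :=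
      ((hasFDerivAt_id z).sub_const x).const_smul _
    have h2 := ((hb.differentiable (by simp)) ((ρ j)⁻¹ • (z - x))).hasFDerivAt.comp z h1
    rw [show η j = (b : E → ℝ) ∘ fun z => (ρ j)⁻¹ • (z - x) from rfl, h2.fderiv]
    ext v
    simp
  have hηA : ∀ j, ∫⁻ z, ‖fderiv ℝ (η j) z‖ₑ ^ (d : ℝ) ∂μ = A := by
    intro j
    have hpos : 0 < (ρ j)⁻¹ := inv_pos.mpr (hρ j)
    simp_rw [hηd, enorm_smul]
    rw [lintegral_sub_right_eq_self
      (fun z => (‖(ρ j)⁻¹‖ₑ * ‖fderiv ℝ b ((ρ j)⁻¹ • z)‖ₑ) ^ (d : ℝ)) x,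
      lintegral_comp_smul_eq μ (fun z => (‖(ρ j)⁻¹‖ₑ * ‖fderiv ℝ b z‖ₑ) ^ (d : ℝ)) hpos]
    simp_rw [ENNReal.mul_rpow_of_nonneg _ _ hd0.le]
    rw [lintegral_const_mul' _ _ (ENNReal.rpow_ne_top_of_nonneg hd0.le enorm_ne_top), ← mul_assoc,
      Real.enorm_eq_ofReal hpos.le, ENNReal.ofReal_rpow_of_pos hpos,
      ← ENNReal.ofReal_mul (by positivity), Real.rpow_natCast, inv_mul_cancel₀ (by positivity),
      ENNReal.ofReal_one, one_mul]
  have hηsupp : ∀ j z, fderiv ℝ (η j) z ≠ 0 → ρ j ≤ ‖z - x‖ ∧ ‖z - x‖ ≤ 2 * ρ j := by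
    intro j z hz
    rw [hηd] at hz
    have h1 := hb0 _ (right_ne_zero_of_smul hz)
    rw [norm_smul, norm_inv, Real.norm_of_nonneg (hρ j).le, inv_mul_eq_div,
      one_le_div (hρ j), div_le_iff₀ (hρ j)] at h1
    exact h1
  have hdisj : ∀ z, ∀ i j, i < j → fderiv ℝ (η i) z ≠ 0 → fderiv ℝ (η j) z = 0 := by
    intro z i j hij hi
    by_contra hj
    have h1 := (hηsupp i z hi).1
    have h2 := (hηsupp j z hj).2
    have h3 : ρ j ≤ ρ i * (1 / 4) := by
      simp only [ρ]
      rw [mul_assoc, ← pow_succ]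
      exact mul_le_mul_of_nonneg_left
        (pow_le_pow_of_le_one (by norm_num) (by norm_num) hij) hr.le
    linarith [hρ i]
  have hφ : ∀ N : ℕ, ContDiff ℝ ∞ fun z => (N : ℝ)⁻¹ * ∑ j ∈ Finset.range N, η j z := fun N =>
    contDiff_const.mul (ContDiff.sum fun j _ => hη j)
  have hφd : ∀ (N : ℕ) z, fderiv ℝ (fun z => (N : ℝ)⁻¹ * ∑ j ∈ Finset.range N, η j z) z =
      (N : ℝ)⁻¹ • ∑ j ∈ Finset.range N, fderiv ℝ (η j) z := by
    intro N z
    have h1 : HasFDerivAt (fun z => ∑ j ∈ Finset.range N, η j z)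
        (∑ j ∈ Finset.range N, fderiv ℝ (η j) z) z :=
      HasFDerivAt.fun_sum fun j _ => (((hη j).differentiable (by simp)) z).hasFDerivAt
    exact (h1.const_mul _).fderiv
  have hbound : ∀ N : ℕ, 1 ≤ N →
      eLpNorm (fderiv ℝ fun z => (N : ℝ)⁻¹ * ∑ j ∈ Finset.range N, η j z) (d : ℝ≥0∞) μ ≤
        (ENNReal.ofReal ((N : ℝ) ^ (1 - d : ℝ)) * A) ^ (1 / (d : ℝ)) := by
    intro N hN
    have hN0 : (0 : ℝ) < N := by exact_mod_cast hN
    rw [eLpNorm_eq_lintegral_rpow_enorm_toReal (by simp; omega) (by simp)]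
    simp only [ENNReal.toReal_natCast]
    gcongr ?_ ^ _
    calc ∫⁻ z, ‖fderiv ℝ (fun z => (N : ℝ)⁻¹ * ∑ j ∈ Finset.range N, η j z) z‖ₑ ^ (d : ℝ) ∂μ
        ≤ ∫⁻ z, ENNReal.ofReal ((N : ℝ)⁻¹ ^ (d : ℝ)) *
            ∑ j ∈ Finset.range N, ‖fderiv ℝ (η j) z‖ₑ ^ (d : ℝ) ∂μ := by
          refine lintegral_mono fun z => ?_
          rw [hφd, enorm_smul, ENNReal.mul_rpow_of_nonneg _ _ hd0.le,
            Real.enorm_eq_ofReal (by positivity), ENNReal.ofReal_rpow_of_pos (by positivity)]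
          gcongr
          refine enorm_sum_rpow_le_of_forall_ne _ _ (fun i _ j _ hi hj => ?_) hd0
          rcases lt_trichotomy i j with h | h | h
          · exact absurd (hdisj z i j h hi) hj
          · exact h
          · exact absurd (hdisj z j i h hj) hi
      _ = ENNReal.ofReal ((N : ℝ) ^ (1 - d : ℝ)) * A := by
          rw [lintegral_const_mul' _ _ ENNReal.ofReal_ne_top, lintegral_finsetSum']
          · simp_rw [hηA]
            rw [Finset.sum_const, Finset.card_range, nsmul_eq_mul, ← mul_assoc,
              ← ENNReal.ofReal_natCast, ← ENNReal.ofReal_mul (by positivity)]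
            congr 2
            rw [Real.rpow_sub hN0, Real.rpow_one, Real.inv_rpow hN0.le]
            ring
          · intro j _
            exact (((hη j).continuous_fderiv (by simp)).measurable.enorm.pow_const _).aemeasurable
  have hlim : Tendsto (fun N : ℕ => (ENNReal.ofReal ((N : ℝ) ^ (1 - d : ℝ)) * A) ^ (1 / (d : ℝ)))
      atTop (𝓝 0) := by
    have h1 : Tendsto (fun N : ℕ => (N : ℝ) ^ (1 - d : ℝ)) atTop (𝓝 0) := by
      have h2 := tendsto_rpow_neg_atTop (y := (d : ℝ) - 1)
        (by have : (2 : ℝ) ≤ d := by exact_mod_cast hd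
            linarith)
      simpa [Function.comp_def] using h2.comp tendsto_natCast_atTop_atTop
    have h3 := ENNReal.tendsto_ofReal h1
    have h4 := ENNReal.Tendsto.mul_const (b := A) h3 (Or.inr hAfin.ne)
    have h5 := h4.ennrpow_const (1 / (d : ℝ))
    simpa [hd0] using h5
  obtain ⟨N, hNε, hN⟩ := ((hlim.eventually_lt_const hε).and (eventually_ge_atTop 1)).exists
  have hN0 : (0 : ℝ) < N := by exact_mod_cast hN
  refine ⟨_, hφ N, ?_, fun z => ?_, ?_, (hbound N hN).trans_lt hNε⟩
  · refine closure_minimal (fun z hz => ?_) isClosed_closedBall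
    by_contra hzb
    refine hz ?_
    have : ∀ j, η j z = 0 := by
      intro j
      refine b.zero_of_le_dist ?_
      rw [mem_closedBall, not_le, dist_eq_norm] at hzb
      rw [dist_zero_right, norm_smul, norm_inv, Real.norm_of_nonneg (hρ j).le, inv_mul_eq_div,
        le_div_iff₀ (hρ j)]
      linarith [hρle j, show b.rOut = 2 from rfl]
    simp [this]
  · exact mul_nonneg (by positivity) (Finset.sum_nonneg fun j _ => b.nonneg)
  · have : ∀ j, η j x = 1 := by
      intro j
      simp only [η, sub_self, smul_zero]
      exact b.eventuallyEq_one.self_of_nhds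
    simp [this, hN0.ne']

theorem exists_smoothAdmissible_singleton_eLpNorm_lt {E : Type*} [NormedAddCommGroup E]
    [InnerProductSpace ℝ E] [FiniteDimensional ℝ E] [MeasurableSpace E] [BorelSpace E]
    (μ : Measure E) [μ.IsAddHaarMeasure] (hd : 2 ≤ Module.finrank ℝ E) {p : ℝ} (hp : 1 ≤ p)
    (hpd : p ≤ Module.finrank ℝ E) {G : Set E} (hG : IsOpen G) {x : E} (hx : x ∈ G)
    {ε : ℝ≥0∞} (hε : 0 < ε) :
    ∃ φ, SmoothAdmissible {x} G φ ∧ eLpNorm (fderiv ℝ φ) (ENNReal.ofReal p) μ < ε := by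
  obtain ⟨r, hr, hrG⟩ := Metric.nhds_basis_closedBall.mem_iff.mp (hG.mem_nhds hx)
  set d := Module.finrank ℝ E with hddef
  -- Hölder's inequality on the ball reduces the exponent from `d` to `p`
  set C := μ (closedBall x r) ^ (1 / p - 1 / (d : ℝ)) with hC
  have hCfin : C ≠ ⊤ := by
    refine ENNReal.rpow_ne_top_of_nonneg ?_ measure_closedBall_lt_top.ne
    rw [sub_nonneg]
    exact one_div_le_one_div_of_le (by linarith) hpd
  have hε' : 0 < ε / C := ENNReal.div_pos hε.ne' hCfin
  obtain ⟨φ, hφ, hφs, hφ0, hφx, hφε⟩ := exists_contDiff_eLpNorm_finrank_fderiv_le μ hd x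
    (half_pos hr) hε'
  rw [mul_div_cancel₀ _ two_ne_zero] at hφs
  refine ⟨φ, ⟨hφ, (isCompact_closedBall x r).of_isClosed_subset (isClosed_tsupport _) hφs,
    hφs.trans hrG, hφ0, fun z hz => by rw [mem_singleton_iff.mp hz, hφx]⟩, ?_⟩
  rw [← eLpNorm_restrict_eq_of_support_subset (f := fderiv ℝ φ)
    ((support_fderiv_subset ℝ).trans hφs)]
  have h1 := eLpNorm_le_eLpNorm_mul_rpow_measure_univ (μ := μ.restrict (closedBall x r))
    (f := fderiv ℝ φ) (p := ENNReal.ofReal p) (q := (d : ℝ≥0∞))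
    (by rw [← ENNReal.ofReal_natCast]; exact ENNReal.ofReal_le_ofReal hpd)
    (hφ.continuous_fderiv (by simp)).aestronglyMeasurable
  rw [Measure.restrict_apply_univ, ENNReal.toReal_ofReal (by linarith),
    ENNReal.toReal_natCast, ← hC] at h1
  refine h1.trans_lt ?_
  refine lt_of_le_of_lt (mul_le_mul_left (eLpNorm_mono_measure _ Measure.restrict_le_self) _) ?_
  exact ENNReal.mul_lt_of_lt_div hφε

/-! ### The plane and exponent one -/

theorem measurePreserving_smul_single_add_smul_single {i j : Fin 2} (hij : i ≠ j) :
    MeasurePreserving (fun q : ℝ × ℝ => (q.1 • EuclideanSpace.single i 1 +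
      q.2 • EuclideanSpace.single j 1 : EuclideanSpace ℝ (Fin 2))) := by
  have h0 : MeasurePreserving (fun q : ℝ × ℝ => (q.1 • EuclideanSpace.single 0 1 +
      q.2 • EuclideanSpace.single 1 1 : EuclideanSpace ℝ (Fin 2))) := by
    have h := (PiLp.volume_preserving_toLp (Fin 2)).comp
      (volume_preserving_finTwoArrow ℝ).symm
    rw [show (fun q : ℝ × ℝ => (q.1 • EuclideanSpace.single 0 1 +
      q.2 • EuclideanSpace.single 1 1 : EuclideanSpace ℝ (Fin 2))) = _ from ?_]
    · exact h
    · funext q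
      ext k
      fin_cases k <;> simp
  have hcases : (i = 0 ∧ j = 1) ∨ (i = 1 ∧ j = 0) := by
    fin_cases i <;> fin_cases j <;> simp_all
  rcases hcases with ⟨rfl, rfl⟩ | ⟨rfl, rfl⟩
  · exact h0
  · have h := h0.comp (Measure.measurePreserving_swap (μ := (volume : Measure ℝ))
      (ν := (volume : Measure ℝ)))
    rw [show (fun q : ℝ × ℝ => (q.1 • EuclideanSpace.single 1 1 +
      q.2 • EuclideanSpace.single 0 1 : EuclideanSpace ℝ (Fin 2))) = _ from ?_]
    · exact h
    · funext q
      simp [add_comm]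

/-- A smooth function on the plane that is at least `1` along a curve has gradient of `L¹` norm at
least the length of the projection of the curve to a coordinate axis: every line orthogonal to that
axis at a point of the projection meets the curve. -/
theorem ofReal_abs_sub_le_eLpNorm_one_fderiv {f : EuclideanSpace ℝ (Fin 2) → ℝ}
    (hf : ContDiff ℝ ∞ f) (hfc : HasCompactSupport f) {S : Set (EuclideanSpace ℝ (Fin 2))}
    (hS : IsPreconnected S) (hfS : ∀ z ∈ S, 1 ≤ f z) {a b : EuclideanSpace ℝ (Fin 2)} (ha : a ∈ S)
    (hb : b ∈ S) (i : Fin 2) :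
    ENNReal.ofReal |b i - a i| ≤ eLpNorm (fderiv ℝ f) 1 volume := by
  obtain ⟨j, hji⟩ : ∃ j : Fin 2, j ≠ i := exists_ne i
  have hmp := measurePreserving_smul_single_add_smul_single hji.symm
  set L : ℝ × ℝ → EuclideanSpace ℝ (Fin 2) := fun q =>
    q.1 • EuclideanSpace.single i 1 + q.2 • EuclideanSpace.single j 1 with hL
  have hLc : Continuous L := by fun_prop
  have hLz : ∀ z, L (z i, z j) = z := by
    intro z
    ext k
    have : k = i ∨ k = j := by
      fin_cases i <;> fin_cases j <;> fin_cases k <;> simp_all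
    rcases this with rfl | rfl
    · simp [hL, hji.symm]
    · simp [hL, hji]
  have hLj : ∀ q, L q j = q.2 := by
    intro q
    simp [hL, hji]
  have hfd : Continuous (fderiv ℝ f) := hf.continuous_fderiv (by simp)
  have hline : ∀ s ∈ uIcc (a i) (b i), 1 ≤ ∫⁻ t, ‖fderiv ℝ f (L (s, t))‖ₑ := by
    intro s hs
    have hpi : ContinuousOn (fun z : EuclideanSpace ℝ (Fin 2) => z i) S := by fun_prop
    obtain ⟨z, hz, rfl⟩ : s ∈ (fun z : EuclideanSpace ℝ (Fin 2) => z i) '' S :=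
      (hS.image _ hpi).ordConnected.uIcc_subset (mem_image_of_mem _ ha) (mem_image_of_mem _ hb) hs
    have hLd : ∀ t, HasDerivAt (fun t => L (z i, t)) (EuclideanSpace.single j 1) t := by
      intro t
      simpa [hL] using ((hasDerivAt_id t).smul_const (EuclideanSpace.single j (1 : ℝ))).const_add
        (z i • EuclideanSpace.single i (1 : ℝ))
    have hh : ContDiff ℝ 1 fun t => f (L (z i, t)) := by
      refine (hf.of_le (by simp)).comp ?_
      exact (contDiff_const (c := z i • EuclideanSpace.single i (1 : ℝ))).add
        (contDiff_id.smul contDiff_const)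
    have hhc : HasCompactSupport fun t => f (L (z i, t)) := by
      refine HasCompactSupport.of_support_subset_isCompact
        (K := (fun w : EuclideanSpace ℝ (Fin 2) => w j) '' tsupport f)
        (hfc.isCompact.image (by fun_prop)) fun t ht => ?_
      exact ⟨L (z i, t), subset_tsupport f ht, hLj _⟩
    calc (1 : ℝ≥0∞) ≤ ‖f (L (z i, z j))‖ₑ := by
          rw [hLz, Real.enorm_eq_ofReal (by linarith [hfS z hz])]
          exact ENNReal.one_le_ofReal.mpr (hfS z hz)
      _ ≤ ∫⁻ t in Iic (z j), ‖deriv (fun t => f (L (z i, t))) t‖ₑ :=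
          hhc.enorm_le_lintegral_Ici_deriv hh _
      _ ≤ ∫⁻ t, ‖deriv (fun t => f (L (z i, t))) t‖ₑ := setLIntegral_le_lintegral _ _
      _ ≤ ∫⁻ t, ‖fderiv ℝ f (L (z i, t))‖ₑ := by
          refine lintegral_mono fun t => ?_
          have h1 := (((hf.differentiable (by simp)) (L (z i, t))).hasFDerivAt.comp_hasDerivAt t
            (hLd t)).deriv
          rw [show (fun t => f (L (z i, t))) = f ∘ fun t => L (z i, t) from rfl, h1]
          refine (ContinuousLinearMap.le_opENorm _ _).trans (mul_le_of_le_one_right zero_le ?_)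
          rw [← ofReal_norm]
          simp
  rw [eLpNorm_one_eq_lintegral_enorm, ← hmp.lintegral_comp hfd.measurable.enorm,
    Measure.volume_eq_prod, lintegral_prod _ (by fun_prop)]
  calc ENNReal.ofReal |b i - a i| = ∫⁻ s in uIcc (a i) (b i), 1 := by
        rw [setLIntegral_one, Real.volume_interval]
    _ ≤ ∫⁻ s in uIcc (a i) (b i), ∫⁻ t, ‖fderiv ℝ f (L (s, t))‖ₑ :=
        setLIntegral_mono' measurableSet_uIcc hline
    _ ≤ _ := setLIntegral_le_lintegral _ _

/-! ### Poincaré and Morrey type estimates -/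

section

variable {E : Type*} [NormedAddCommGroup E] [NormedSpace ℝ E]

theorem enorm_add_sub_le_lintegral_fderiv {f : E → ℝ} (hf : ContDiff ℝ ∞ f) (x h : E) :
    ‖f (x + h) - f x‖ₑ ≤ ∫⁻ t in Icc (0 : ℝ) 1, ‖fderiv ℝ f (x + t • h)‖ₑ * ‖h‖ₑ := by
  have hl : ∀ t : ℝ, HasDerivAt (fun t : ℝ => x + t • h) h t := fun t => by
    simpa using ((hasDerivAt_id t).smul_const h).const_add x
  have hc : ContDiff ℝ 1 fun t : ℝ => f (x + t • h) :=
    (hf.of_le (by simp)).comp (contDiff_const.add (contDiff_id.smul contDiff_const))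
  have h1 := enorm_sub_le_lintegral_deriv_of_contDiffOn_Icc hc.contDiffOn zero_le_one
  simp only [one_smul, zero_smul, add_zero] at h1
  refine h1.trans (lintegral_mono fun t => ?_)
  rw [show (fun t : ℝ => f (x + t • h)) = f ∘ fun t : ℝ => x + t • h from rfl,
    (((hf.differentiable (by simp)) (x + t • h)).hasFDerivAt.comp_hasDerivAt t (hl t)).deriv]
  exact ContinuousLinearMap.le_opENorm _ _

variable [FiniteDimensional ℝ E] [MeasurableSpace E] [BorelSpace E] (μ : Measure E)
  [μ.IsAddHaarMeasure]

theorem lintegral_enorm_add_sub_rpow_le {p : ℝ} (hp : 1 ≤ p) {f : E → ℝ} (hf : ContDiff ℝ ∞ f)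
    (h : E) : ∫⁻ x, ‖f (x + h) - f x‖ₑ ^ p ∂μ ≤ ‖h‖ₑ ^ p * ∫⁻ x, ‖fderiv ℝ f x‖ₑ ^ p ∂μ := by
  have hp0 : 0 ≤ p := by linarith
  have hfd : Continuous (fderiv ℝ f) := hf.continuous_fderiv (by simp)
  have hpt : ∀ x, ‖f (x + h) - f x‖ₑ ^ p ≤
      ∫⁻ t in Icc (0 : ℝ) 1, ‖fderiv ℝ f (x + t • h)‖ₑ ^ p * ‖h‖ₑ ^ p := by
    intro x
    have hm : Continuous fun t : ℝ => ‖fderiv ℝ f (x + t • h)‖ₑ := by fun_prop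
    have h1 := lintegral_rpow_le_measure_univ_rpow_mul
      (μ := (volume : Measure ℝ).restrict (Icc 0 1)) hp
      (hm.measurable.mul_const ‖h‖ₑ).aemeasurable
    simp only [Measure.restrict_apply_univ, Real.volume_Icc, sub_zero, ENNReal.ofReal_one,
      ENNReal.one_rpow, one_mul, ENNReal.mul_rpow_of_nonneg _ _ hp0] at h1
    exact (ENNReal.rpow_le_rpow (enorm_add_sub_le_lintegral_fderiv hf x h) hp0).trans h1
  refine (lintegral_mono hpt).trans ?_
  have hm2 : Measurable fun q : E × ℝ => ‖fderiv ℝ f (q.1 + q.2 • h)‖ₑ ^ p := by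
    have : Continuous fun q : E × ℝ => ‖fderiv ℝ f (q.1 + q.2 • h)‖ₑ := by fun_prop
    exact this.measurable.pow_const p
  rw [lintegral_lintegral_swap (hm2.mul_const _).aemeasurable]
  have h2 : ∀ t : ℝ, ∫⁻ x, ‖fderiv ℝ f (x + t • h)‖ₑ ^ p * ‖h‖ₑ ^ p ∂μ =
      ‖h‖ₑ ^ p * ∫⁻ x, ‖fderiv ℝ f x‖ₑ ^ p ∂μ := by
    intro t
    rw [lintegral_mul_const' _ _ (ENNReal.rpow_ne_top_of_nonneg hp0 enorm_ne_top),
      lintegral_add_right_eq_self (fun x => ‖fderiv ℝ f x‖ₑ ^ p), mul_comm]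
  simp [h2]

theorem enorm_sub_setAverage_le {f : E → ℝ} (hf : Continuous f) (z : E) {R : ℝ} (hR : 0 < R)
    (x : E) : ‖f x - ⨍ y in closedBall z R, f y ∂μ‖ₑ ≤
      (μ (closedBall z R))⁻¹ * ∫⁻ y in closedBall z R, ‖f y - f x‖ₑ ∂μ := by
  have hpos : 0 < μ (closedBall z R) := measure_closedBall_pos μ z hR
  have hfin : μ (closedBall z R) < ⊤ := measure_closedBall_lt_top
  have hint : IntegrableOn f (closedBall z R) μ :=
    hf.continuousOn.integrableOn_compact (isCompact_closedBall z R)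
  have hc : ⨍ _ in closedBall z R, f x ∂μ = f x := setAverage_const hpos.ne' hfin.ne _
  have h1 : f x - ⨍ y in closedBall z R, f y ∂μ =
      -((μ.real (closedBall z R))⁻¹ • ∫ y in closedBall z R, (f y - f x) ∂μ) := by
    rw [integral_sub hint (integrableOn_const hfin.ne), smul_sub, ← setAverage_eq,
      ← setAverage_eq, hc, neg_sub]
  rw [h1, enorm_neg, enorm_smul]
  have h2 : ‖(μ.real (closedBall z R))⁻¹‖ₑ = (μ (closedBall z R))⁻¹ := by
    rw [Real.enorm_eq_ofReal (by positivity), measureReal_def,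
      ENNReal.ofReal_inv_of_pos (ENNReal.toReal_pos hpos.ne' hfin.ne),
      ENNReal.ofReal_toReal hfin.ne]
  rw [h2]
  gcongr
  exact enorm_integral_le_lintegral_enorm _

/-- A Poincaré inequality on balls, with the energy over the whole space on the right. -/
theorem exists_eLpNorm_sub_setAverage_le {p : ℝ} (hp : 1 ≤ p) {R : ℝ} (hR : 0 < R) :
    ∃ C : ℝ≥0∞, C ≠ ⊤ ∧ ∀ f : E → ℝ, ContDiff ℝ ∞ f → ∀ z,
      eLpNorm (fun x => f x - ⨍ y in closedBall z R, f y ∂μ) (ENNReal.ofReal p)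
        (μ.restrict (closedBall z R)) ≤ C * eLpNorm (fderiv ℝ f) (ENNReal.ofReal p) μ := by
  have hp0 : 0 < p := by linarith
  set V := μ (closedBall (0 : E) R) with hV
  have hV0 : V ≠ 0 := (measure_closedBall_pos μ 0 hR).ne'
  have hVt : V ≠ ⊤ := measure_closedBall_lt_top.ne
  set W := μ (closedBall (0 : E) (2 * R)) with hW
  have hWt : W ≠ ⊤ := measure_closedBall_lt_top.ne
  refine ⟨(V⁻¹ * (W * ENNReal.ofReal (2 * R) ^ p)) ^ (1 / p),
    ENNReal.rpow_ne_top_of_nonneg (by positivity) (ENNReal.mul_ne_top (ENNReal.inv_ne_top.mpr hV0)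
      (ENNReal.mul_ne_top hWt (ENNReal.rpow_ne_top_of_nonneg hp0.le ENNReal.ofReal_ne_top))),
    fun f hf z => ?_⟩
  have hVz : μ (closedBall z R) = V := by rw [hV, ← μ.addHaar_closedBall_center z R]
  rw [eLpNorm_eq_lintegral_rpow_enorm_toReal (by simpa using hp0) ENNReal.ofReal_ne_top,
    eLpNorm_eq_lintegral_rpow_enorm_toReal (by simpa using hp0) ENNReal.ofReal_ne_top,
    ENNReal.toReal_ofReal hp0.le, ← ENNReal.mul_rpow_of_nonneg _ _ (by positivity)]
  gcongr ?_ ^ _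
  have hpt : ∀ x, ‖f x - ⨍ y in closedBall z R, f y ∂μ‖ₑ ^ p ≤
      V⁻¹ * ∫⁻ y in closedBall z R, ‖f y - f x‖ₑ ^ p ∂μ := by
    intro x
    have hm : Measurable fun y => ‖f y - f x‖ₑ :=
      (hf.continuous.sub continuous_const).measurable.enorm
    calc ‖f x - ⨍ y in closedBall z R, f y ∂μ‖ₑ ^ p
        ≤ (V⁻¹ * ∫⁻ y in closedBall z R, ‖f y - f x‖ₑ ∂μ) ^ p := by
          rw [← hVz]
          gcongr
          exact enorm_sub_setAverage_le μ hf.continuous z hR x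
      _ ≤ V⁻¹ ^ p * (V ^ (p - 1) * ∫⁻ y in closedBall z R, ‖f y - f x‖ₑ ^ p ∂μ) := by
          rw [ENNReal.mul_rpow_of_nonneg _ _ hp0.le]
          gcongr
          have := lintegral_rpow_le_measure_univ_rpow_mul (μ := μ.restrict (closedBall z R)) hp
            hm.aemeasurable
          rwa [Measure.restrict_apply_univ, hVz] at this
      _ = V⁻¹ * ∫⁻ y in closedBall z R, ‖f y - f x‖ₑ ^ p ∂μ := by
          rw [← mul_assoc, ENNReal.inv_rpow, ← ENNReal.rpow_neg, ← ENNReal.rpow_add _ _ hV0 hVt,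
            ← ENNReal.rpow_neg_one, show -p + (p - 1) = -1 by ring]
  have hm1 : Measurable fun q : E × E => ‖f (q.1 + q.2) - f q.1‖ₑ ^ p := by
    have : Continuous fun q : E × E => ‖f (q.1 + q.2) - f q.1‖ₑ := by
      have := hf.continuous
      fun_prop
    exact this.measurable.pow_const p
  -- differences of points of the ball lie in the ball of twice the radius
  have hinner : ∀ x ∈ closedBall z R, ∫⁻ y in closedBall z R, ‖f y - f x‖ₑ ^ p ∂μ ≤
      ∫⁻ h in closedBall (0 : E) (2 * R), ‖f (x + h) - f x‖ₑ ^ p ∂μ := by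
    intro x hx
    rw [← lintegral_indicator measurableSet_closedBall,
      ← lintegral_indicator measurableSet_closedBall,
      ← lintegral_add_left_eq_self _ x]
    refine lintegral_mono fun h => ?_
    by_cases hh : x + h ∈ closedBall z R
    · have hh' : h ∈ closedBall (0 : E) (2 * R) := by
        rw [mem_closedBall_zero_iff]
        calc ‖h‖ = dist (x + h) x := by simp
          _ ≤ dist (x + h) z + dist x z := dist_triangle_right _ _ _
          _ ≤ 2 * R := by
            have h1 := mem_closedBall.mp hh
            have h2 := mem_closedBall.mp hx
            linarith
      simp only [indicator_of_mem hh, indicator_of_mem hh']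
      exact le_rfl
    · rw [indicator_of_notMem hh]
      exact zero_le
  calc ∫⁻ x in closedBall z R, ‖f x - ⨍ y in closedBall z R, f y ∂μ‖ₑ ^ p ∂μ
      ≤ ∫⁻ x in closedBall z R,
          V⁻¹ * ∫⁻ h in closedBall (0 : E) (2 * R), ‖f (x + h) - f x‖ₑ ^ p ∂μ ∂μ :=
        setLIntegral_mono' measurableSet_closedBall fun x hx =>
          (hpt x).trans (by gcongr V⁻¹ * ?_; exact hinner x hx)
    _ ≤ V⁻¹ * ∫⁻ x, ∫⁻ h in closedBall (0 : E) (2 * R), ‖f (x + h) - f x‖ₑ ^ p ∂μ ∂μ := by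
        rw [lintegral_const_mul' _ _ (ENNReal.inv_ne_top.mpr hV0)]
        gcongr
        exact Measure.restrict_le_self
    _ = V⁻¹ * ∫⁻ h in closedBall (0 : E) (2 * R), ∫⁻ x, ‖f (x + h) - f x‖ₑ ^ p ∂μ ∂μ := by
        rw [lintegral_lintegral_swap hm1.aemeasurable]
    _ ≤ V⁻¹ * ∫⁻ _ in closedBall (0 : E) (2 * R),
          ENNReal.ofReal (2 * R) ^ p * ∫⁻ x, ‖fderiv ℝ f x‖ₑ ^ p ∂μ ∂μ := by
        gcongr V⁻¹ * ?_
        refine setLIntegral_mono' measurableSet_closedBall fun h hh => ?_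
        refine (lintegral_enorm_add_sub_rpow_le μ hp hf h).trans ?_
        gcongr
        rw [← ofReal_norm]
        exact ENNReal.ofReal_le_ofReal (mem_closedBall_zero_iff.mp hh)
    _ = V⁻¹ * (W * ENNReal.ofReal (2 * R) ^ p) * ∫⁻ x, ‖fderiv ℝ f x‖ₑ ^ p ∂μ := by
        rw [setLIntegral_const]
        ring

end

section

variable {E : Type*} [NormedAddCommGroup E] [NormedSpace ℝ E] [FiniteDimensional ℝ E]
  [MeasurableSpace E] [BorelSpace E] (μ : Measure E) [μ.IsAddHaarMeasure]

theorem lintegral_rpow_Icc_zero_one_lt_top {s : ℝ} (hs : -1 < s) :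
    ∫⁻ t in Icc (0 : ℝ) 1, ENNReal.ofReal (t ^ s) < ⊤ := by
  have h := (intervalIntegral.intervalIntegrable_rpow' (a := 0) (b := 1) hs).1
  rw [restrict_Ioc_eq_restrict_Icc.symm]
  exact h.lintegral_lt_top

/-- A Morrey type estimate: if the energy in the ball of radius `ρ` about `z` is at most `c * ρ` for
every `ρ ≤ R`, with `c` small, then `f z` is close to the mean of `f` over the ball of radius `R`.
The mean oscillation is controlled by integrals of the gradient over the balls of radius `t * R`,
`0 < t ≤ 1`, which contribute a multiple of `t ^ ((1 - d) / p)`; this is integrable since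
`p > d - 1`. -/
theorem exists_abs_sub_setAverage_le_of_lintegral_closedBall_le {p : ℝ} (hp : 1 ≤ p)
    (hpd : (Module.finrank ℝ E : ℝ) - 1 < p) {R : ℝ} (hR : 0 < R) :
    ∃ c : ℝ, 0 < c ∧ ∀ f : E → ℝ, ContDiff ℝ ∞ f → ∀ z,
      (∀ ρ, 0 < ρ → ρ ≤ R →
        ∫⁻ x in closedBall z ρ, ‖fderiv ℝ f x‖ₑ ^ p ∂μ ≤ ENNReal.ofReal (c * ρ)) →
      |f z - ⨍ y in closedBall z R, f y ∂μ| ≤ 1 / 4 := by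
  have hp0 : 0 < p := by linarith
  set d := Module.finrank ℝ E with hd
  set V := μ (closedBall (0 : E) R) with hV
  have hV0 : V ≠ 0 := (measure_closedBall_pos μ 0 hR).ne'
  have hVt : V ≠ ⊤ := measure_closedBall_lt_top.ne
  set I := ∫⁻ t in Icc (0 : ℝ) 1, ENNReal.ofReal (t ^ ((1 - d) / p)) with hI
  have hIt : I < ⊤ := lintegral_rpow_Icc_zero_one_lt_top (by
    rw [lt_div_iff₀ hp0]
    linarith)
  set D := V⁻¹ * (ENNReal.ofReal R * ((V ^ (p - 1) * ENNReal.ofReal R) ^ (1 / p) * I)) with hD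
  have hDt : D ≠ ⊤ := by
    refine ENNReal.mul_ne_top (ENNReal.inv_ne_top.mpr hV0) (ENNReal.mul_ne_top ENNReal.ofReal_ne_top
      (ENNReal.mul_ne_top (ENNReal.rpow_ne_top_of_nonneg (by positivity)
        (ENNReal.mul_ne_top (ENNReal.rpow_ne_top_of_nonneg (by linarith) hVt)
          ENNReal.ofReal_ne_top)) hIt.ne))
  -- the constant `c` is chosen to make the final bound `D * c ^ (1 / p)` small
  obtain ⟨c, hcD, hc⟩ : ∃ c : ℝ, D * ENNReal.ofReal c ^ (1 / p) < ENNReal.ofReal (1 / 4) ∧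
      0 < c := by
    have h1 : Tendsto (fun c : ℝ => D * ENNReal.ofReal c ^ (1 / p)) (𝓝[>] 0) (𝓝 0) := by
      have h2 : Tendsto (fun c : ℝ => ENNReal.ofReal c) (𝓝[>] 0) (𝓝 0) := by
        simpa using (ENNReal.continuous_ofReal.tendsto 0).mono_left nhdsWithin_le_nhds
      have h3 := ENNReal.Tendsto.const_mul (a := D) (h2.ennrpow_const (1 / p)) (Or.inr hDt)
      simpa [hp0] using h3
    exact ((h1.eventually_lt_const (by simp)).and self_mem_nhdsWithin).exists
  refine ⟨c, hc, fun f hf z hz => ?_⟩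
  have hVz : μ (closedBall z R) = V := by rw [hV, ← μ.addHaar_closedBall_center z R]
  have hfd : Continuous (fderiv ℝ f) := hf.continuous_fderiv (by simp)
  have hshift : ∀ (ρ : ℝ) (F : E → ℝ≥0∞),
      ∫⁻ h in closedBall (0 : E) ρ, F (z + h) ∂μ = ∫⁻ y in closedBall z ρ, F y ∂μ := by
    intro ρ F
    rw [← lintegral_indicator measurableSet_closedBall,
      ← lintegral_indicator measurableSet_closedBall,
      ← lintegral_add_left_eq_self ((closedBall z ρ).indicator F) z]
    refine lintegral_congr fun h => ?_
    simp [indicator, dist_eq_norm]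
  -- Jensen on the ball and the substitution `y = z + t • h`
  have hinner : ∀ t ∈ Ioc (0 : ℝ) 1,
      ∫⁻ h in closedBall (0 : E) R, ‖fderiv ℝ f (z + t • h)‖ₑ ∂μ ≤
        (V ^ (p - 1) * ENNReal.ofReal R) ^ (1 / p) * ENNReal.ofReal c ^ (1 / p) *
          ENNReal.ofReal (t ^ ((1 - d) / p)) := by
    intro t ht
    have hm : Continuous fun h => ‖fderiv ℝ f (z + t • h)‖ₑ := by fun_prop
    have h1 := lintegral_rpow_le_measure_univ_rpow_mul (μ := μ.restrict (closedBall (0 : E) R)) hp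
      hm.measurable.aemeasurable
    rw [Measure.restrict_apply_univ, ← hV] at h1
    have h2 : ∫⁻ h in closedBall (0 : E) R, ‖fderiv ℝ f (z + t • h)‖ₑ ^ p ∂μ =
        ENNReal.ofReal (t ^ d)⁻¹ * ∫⁻ y in closedBall z (t * R), ‖fderiv ℝ f y‖ₑ ^ p ∂μ := by
      rw [← hshift, ← lintegral_indicator measurableSet_closedBall,
        ← lintegral_indicator measurableSet_closedBall, ← lintegral_comp_smul_eq μ _ ht.1]
      refine lintegral_congr fun h => ?_
      have : t • h ∈ closedBall (0 : E) (t * R) ↔ h ∈ closedBall (0 : E) R := by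
        rw [mem_closedBall_zero_iff, mem_closedBall_zero_iff, norm_smul,
          Real.norm_of_nonneg ht.1.le, mul_le_mul_iff_right₀ ht.1]
      by_cases hh : h ∈ closedBall (0 : E) R
      · rw [indicator_of_mem hh, indicator_of_mem (this.mpr hh)]
      · rw [indicator_of_notMem hh, indicator_of_notMem fun h' => hh (this.mp h')]
    have h3 : (∫⁻ h in closedBall (0 : E) R, ‖fderiv ℝ f (z + t • h)‖ₑ ∂μ) ^ p ≤
        V ^ (p - 1) * ENNReal.ofReal R * ENNReal.ofReal c * ENNReal.ofReal (t ^ (1 - d : ℝ)) := by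
      refine h1.trans ?_
      rw [h2]
      calc V ^ (p - 1) * (ENNReal.ofReal (t ^ d)⁻¹ *
            ∫⁻ y in closedBall z (t * R), ‖fderiv ℝ f y‖ₑ ^ p ∂μ)
          ≤ V ^ (p - 1) * (ENNReal.ofReal (t ^ d)⁻¹ * ENNReal.ofReal (c * (t * R))) := by
            gcongr
            exact hz _ (mul_pos ht.1 hR) (mul_le_of_le_one_left hR.le ht.2)
        _ = _ := by
            have ht0 : 0 < t := ht.1
            rw [mul_assoc, mul_assoc, ← ENNReal.ofReal_mul (by positivity),
              ← ENNReal.ofReal_mul hc.le, ← ENNReal.ofReal_mul hR.le, Real.rpow_sub ht.1,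
              Real.rpow_one, Real.rpow_natCast]
            congr 2
            field_simp
    have h4 := ENNReal.rpow_le_rpow h3 (by positivity : 0 ≤ 1 / p)
    rw [← ENNReal.rpow_mul, mul_one_div_cancel hp0.ne', ENNReal.rpow_one,
      ENNReal.mul_rpow_of_nonneg _ _ (by positivity),
      ENNReal.mul_rpow_of_nonneg _ _ (by positivity),
      ENNReal.ofReal_rpow_of_pos (Real.rpow_pos_of_pos ht.1 _), ← Real.rpow_mul ht.1.le,
      mul_one_div] at h4
    exact h4
  have hm2 : Measurable fun q : E × ℝ => ‖fderiv ℝ f (z + q.2 • q.1)‖ₑ := by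
    have : Continuous fun q : E × ℝ => ‖fderiv ℝ f (z + q.2 • q.1)‖ₑ := by fun_prop
    exact this.measurable
  have hmain : ‖f z - ⨍ y in closedBall z R, f y ∂μ‖ₑ ≤ D * ENNReal.ofReal c ^ (1 / p) := by
    calc ‖f z - ⨍ y in closedBall z R, f y ∂μ‖ₑ
        ≤ V⁻¹ * ∫⁻ y in closedBall z R, ‖f y - f z‖ₑ ∂μ := by
          rw [← hVz]
          exact enorm_sub_setAverage_le μ hf.continuous z hR z
      _ = V⁻¹ * ∫⁻ h in closedBall (0 : E) R, ‖f (z + h) - f z‖ₑ ∂μ := by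
          rw [hshift R fun y => ‖f y - f z‖ₑ]
      _ ≤ V⁻¹ * ∫⁻ h in closedBall (0 : E) R, (∫⁻ t in Icc (0 : ℝ) 1,
            ‖fderiv ℝ f (z + t • h)‖ₑ * ENNReal.ofReal R) ∂μ := by
          gcongr V⁻¹ * ?_
          refine setLIntegral_mono' measurableSet_closedBall fun h hh => ?_
          refine (enorm_add_sub_le_lintegral_fderiv hf z h).trans ?_
          gcongr with t
          rw [← ofReal_norm]
          exact ENNReal.ofReal_le_ofReal (mem_closedBall_zero_iff.mp hh)
      _ = V⁻¹ * ∫⁻ t in Icc (0 : ℝ) 1, (∫⁻ h in closedBall (0 : E) R,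
            ‖fderiv ℝ f (z + t • h)‖ₑ ∂μ) * ENNReal.ofReal R := by
          rw [lintegral_lintegral_swap (hm2.mul_const _).aemeasurable]
          simp_rw [lintegral_mul_const' _ _ ENNReal.ofReal_ne_top]
      _ ≤ V⁻¹ * ∫⁻ t in Icc (0 : ℝ) 1, (V ^ (p - 1) * ENNReal.ofReal R) ^ (1 / p) *
            ENNReal.ofReal c ^ (1 / p) * ENNReal.ofReal (t ^ ((1 - d) / p)) *
              ENNReal.ofReal R := by
          rw [← restrict_Ioc_eq_restrict_Icc]
          gcongr V⁻¹ * ?_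
          refine setLIntegral_mono' measurableSet_Ioc fun t ht => ?_
          gcongr
          exact hinner t ht
      _ = D * ENNReal.ofReal c ^ (1 / p) := by
          rw [lintegral_mul_const' _ _ ENNReal.ofReal_ne_top, lintegral_const_mul, ← hI, hD]
          · ring
          · fun_prop
  rw [Real.enorm_eq_ofReal_abs] at hmain
  exact (ENNReal.ofReal_le_ofReal_iff (by norm_num)).mp (hmain.trans hcD.le)

end

/-! ### Functions that are large on a connected set -/

/-- A covering argument. If every point of a connected set `S` near `z₀` is the centre of a ball
whose mass for the density `k` is at least a multiple of its radius, then the total mass is at least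
a multiple of the distance `δ` that `S` reaches: a disjoint subfamily of these balls covers after
enlargement, and the distances to `z₀` of the points of `S` fill the interval `[0, δ]`. -/
theorem IsPreconnected.ofReal_le_lintegral_of_forall_closedBall {E : Type*} [PseudoMetricSpace E]
    [TopologicalSpace.SeparableSpace E] [MeasurableSpace E] [BorelSpace E] (μ : Measure E)
    {S : Set E} (hS : IsPreconnected S) {z₀ w : E} (hz₀ : z₀ ∈ S) (hw : w ∈ S) {δ : ℝ}
    (hδ : δ ≤ dist w z₀)
    {c R : ℝ} (hc : 0 ≤ c) {k : E → ℝ≥0∞}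
    (hk : ∀ z ∈ S, dist z z₀ ≤ δ → ∃ ρ, 0 < ρ ∧ ρ ≤ R ∧
      ENNReal.ofReal (c * ρ) ≤ ∫⁻ x in closedBall z ρ, k x ∂μ) :
    ENNReal.ofReal (c * δ / 10) ≤ ∫⁻ x, k x ∂μ := by
  have hk' : ∀ z, ∃ ρ, z ∈ S ∩ closedBall z₀ δ → 0 < ρ ∧ ρ ≤ R ∧
      ENNReal.ofReal (c * ρ) ≤ ∫⁻ x in closedBall z ρ, k x ∂μ := by
    intro z
    by_cases hz : z ∈ S ∩ closedBall z₀ δ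
    · obtain ⟨ρ, h⟩ := hk z hz.1 hz.2
      exact ⟨ρ, fun _ => h⟩
    · exact ⟨0, fun h => absurd h hz⟩
  choose ρ hρ using hk'
  obtain ⟨u, hut, hdisj, hcov⟩ := Vitali.exists_disjoint_subfamily_covering_enlargement_closedBall
    (S ∩ closedBall z₀ δ) id ρ R (fun a ha => (hρ a ha).2.1) 5 (by norm_num)
  have hu : u.Countable := hdisj.countable_of_nonempty_interior fun a ha =>
    ⟨a, ball_subset_interior_closedBall (mem_ball_self (hρ a (hut ha)).1)⟩
  have hIcc : Icc 0 δ ⊆ ⋃ b ∈ u, closedBall (dist b z₀) (5 * ρ b) := by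
    intro s hs
    obtain ⟨z, hz, rfl⟩ : s ∈ (fun z => dist z z₀) '' S := by
      refine (hS.image (fun z => dist z z₀) (by fun_prop)).ordConnected.out (x := 0)
        (y := dist w z₀)
        ⟨z₀, hz₀, dist_self _⟩ ⟨w, hw, rfl⟩ ⟨hs.1, hs.2.trans hδ⟩
    obtain ⟨b, hb, hsub⟩ := hcov z ⟨hz, hs.2⟩
    have h1 : z ∈ closedBall b (5 * ρ b) := hsub (mem_closedBall_self (hρ z ⟨hz, hs.2⟩).1.le)
    refine mem_biUnion hb ?_
    rw [mem_closedBall, Real.dist_eq]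
    exact (abs_dist_sub_le z b z₀).trans h1
  have h2 : ENNReal.ofReal δ ≤ ∑' b : u, ENNReal.ofReal (10 * ρ b) := by
    calc ENNReal.ofReal δ = volume (Icc 0 δ) := by rw [Real.volume_Icc, sub_zero]
      _ ≤ volume (⋃ b ∈ u, closedBall (dist b z₀) (5 * ρ b)) := measure_mono hIcc
      _ ≤ ∑' b : u, volume (closedBall (dist b.1 z₀) (5 * ρ b)) := measure_biUnion_le _ hu _
      _ = ∑' b : u, ENNReal.ofReal (10 * ρ b) := by
        simp_rw [Real.volume_closedBall]
        ring_nf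
  calc ENNReal.ofReal (c * δ / 10) = ENNReal.ofReal (c / 10) * ENNReal.ofReal δ := by
        rw [← ENNReal.ofReal_mul (by positivity)]
        ring_nf
    _ ≤ ENNReal.ofReal (c / 10) * ∑' b : u, ENNReal.ofReal (10 * ρ b) := by gcongr
    _ = ∑' b : u, ENNReal.ofReal (c * ρ b) := by
        rw [← ENNReal.tsum_mul_left]
        refine tsum_congr fun b => ?_
        rw [← ENNReal.ofReal_mul (by positivity)]
        ring_nf
    _ ≤ ∑' b : u, ∫⁻ x in closedBall b.1 (ρ b), k x ∂μ :=
        ENNReal.tsum_le_tsum fun b => (hρ b (hut b.2)).2.2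
    _ = ∫⁻ x in ⋃ b ∈ u, closedBall b (ρ b), k x ∂μ :=
        (lintegral_biUnion hu (fun _ _ => measurableSet_closedBall) hdisj k).symm
    _ ≤ ∫⁻ x, k x ∂μ := setLIntegral_le_lintegral _ _

/-- If a smooth function is at least `1` on a connected set of diameter bounded below and has small
energy of exponent `p > d - 1`, then on a given ball it is close in `L^p` to a constant that is
not small. -/
theorem exists_eLpNorm_sub_const_le {E : Type*} [NormedAddCommGroup E] [NormedSpace ℝ E]
    [FiniteDimensional ℝ E] [MeasurableSpace E] [BorelSpace E] (μ : Measure E)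
    [μ.IsAddHaarMeasure] {p : ℝ} (hp : 1 ≤ p) (hpd : (Module.finrank ℝ E : ℝ) - 1 < p) {R : ℝ}
    (hR : 0 ≤ R) {δ : ℝ} (hδ : 0 < δ) {η : ℝ≥0∞} (hη : 0 < η) :
    ∃ ε : ℝ≥0∞, 0 < ε ∧ ∀ f : E → ℝ, ContDiff ℝ ∞ f → ∀ S : Set E, IsPreconnected S →
      (∀ z ∈ S, 1 ≤ f z) → ∀ z₀ ∈ S, ∀ w ∈ S, δ ≤ dist w z₀ →
      eLpNorm (fderiv ℝ f) (ENNReal.ofReal p) μ < ε →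
      ∃ a : ℝ, 1 / 2 ≤ a ∧
        eLpNorm (fun x => f x - a) (ENNReal.ofReal p) (μ.restrict (closedBall z₀ R)) ≤ η := by
  have hp0 : 0 < p := by linarith
  obtain ⟨c, hc, hmor⟩ := exists_abs_sub_setAverage_le_of_lintegral_closedBall_le μ hp hpd
    (add_pos_of_nonneg_of_pos hR hδ)
  obtain ⟨C, hC, hpoin⟩ := exists_eLpNorm_sub_setAverage_le μ hp (add_pos_of_nonneg_of_pos hR hδ)
  refine ⟨min (ENNReal.ofReal (c * δ / 10) ^ (1 / p)) (η / C),
    lt_min (ENNReal.rpow_pos (by simpa using by positivity) ENNReal.ofReal_ne_top)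
      (ENNReal.div_pos hη.ne' hC), fun f hf S hS hfS z₀ hz₀ w hw hδw hε => ?_⟩
  -- the ball of radius `R + δ` about `z` contains the ball of radius `R` about `z₀`
  obtain ⟨z, hzS, hzδ, hz⟩ : ∃ z ∈ S, dist z z₀ ≤ δ ∧ ∀ ρ, 0 < ρ → ρ ≤ R + δ →
      ∫⁻ x in closedBall z ρ, ‖fderiv ℝ f x‖ₑ ^ p ∂μ ≤ ENNReal.ofReal (c * ρ) := by
    by_contra! hcon
    have h1 := hS.ofReal_le_lintegral_of_forall_closedBall μ hz₀ hw hδw hc.le (R := R + δ)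
      (k := fun x => ‖fderiv ℝ f x‖ₑ ^ p) fun z hz hzd => by
        obtain ⟨ρ, hρ, hρR, h⟩ := hcon z hz hzd
        exact ⟨ρ, hρ, hρR, h.le⟩
    have h2 := hε.trans_le (min_le_left _ _)
    rw [eLpNorm_eq_lintegral_rpow_enorm_toReal (by simpa using hp0) ENNReal.ofReal_ne_top,
      ENNReal.toReal_ofReal hp0.le] at h2
    exact absurd (ENNReal.rpow_le_rpow h1 (by positivity)) (not_le.mpr h2)
  refine ⟨⨍ y in closedBall z (R + δ), f y ∂μ, ?_, ?_⟩
  · have h1 := (abs_le.mp (hmor f hf z hz)).2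
    have h2 := hfS z hzS
    linarith
  · have hsub : closedBall z₀ R ⊆ closedBall z (R + δ) :=
      closedBall_subset_closedBall' (by rw [dist_comm z₀ z]; linarith)
    calc _ ≤ eLpNorm (fun x => f x - ⨍ y in closedBall z (R + δ), f y ∂μ) (ENNReal.ofReal p)
          (μ.restrict (closedBall z (R + δ))) :=
          eLpNorm_mono_measure _ (Measure.restrict_mono hsub le_rfl)
      _ ≤ C * eLpNorm (fderiv ℝ f) (ENNReal.ofReal p) μ := hpoin f hf z
      _ ≤ η := by
        rw [mul_comm]
        exact (ENNReal.mul_lt_of_lt_div (hε.trans_le (min_le_right _ _))).le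

/-! ### Sets of zero Sobolev capacity -/

/-- A set has zero Sobolev capacity as soon as, for every ball, there are smooth functions equal to
`1` near the set that are small in `L^p` of the ball and have small energy. The competitors for
concentric balls are glued along a partition of unity subordinate to annuli. -/
theorem sobolevCapacity_eq_zero_of_forall_exists {n : ℕ} {p : ℝ} (hp : 1 ≤ p)
    {A : Set (EuclideanSpace ℝ (Fin n))} (x₀ : EuclideanSpace ℝ (Fin n))
    (hA : ∀ R : ℝ, 0 ≤ R → ∀ η : ℝ≥0∞, 0 < η → ∃ w : EuclideanSpace ℝ (Fin n) → ℝ,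
      ContDiff ℝ ∞ w ∧ (∀ᶠ x in 𝓝ˢ A, w x = 1) ∧
      eLpNorm w (ENNReal.ofReal p) (volume.restrict (closedBall x₀ R)) ≤ η ∧
      eLpNorm (fderiv ℝ w) (ENNReal.ofReal p) volume ≤ η) :
    sobolevCapacity p A = 0 := by
  have hp0 : 0 < p := by linarith
  have hp1 : 1 ≤ ENNReal.ofReal p := ENNReal.one_le_ofReal.mpr hp
  suffices h : ∀ ε : ℝ, 0 < ε → sobolevCapacity p A ≤ 2 * ENNReal.ofReal ε ^ p by
    have ht : Tendsto (fun ε : ℝ => 2 * ENNReal.ofReal ε ^ p) (𝓝[>] 0) (𝓝 0) := by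
      have h2 : Tendsto (fun ε : ℝ => ENNReal.ofReal ε) (𝓝[>] 0) (𝓝 0) := by
        simpa using (ENNReal.continuous_ofReal.tendsto 0).mono_left nhdsWithin_le_nhds
      have h3 := ENNReal.Tendsto.const_mul (a := 2) (h2.ennrpow_const p) (Or.inr (by simp))
      simpa [hp0] using h3
    exact nonpos_iff_eq_zero.mp (ge_of_tendsto ht (eventually_mem_nhdsWithin.mono h))
  intro ε hε
  -- `θ j` is `1` on the ball of radius `j + 1` and `χ j` lives on an annulus; the sum of the first
  -- `N + 1` functions `χ j` telescopes to `θ N`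
  let θ : (j : ℕ) → ContDiffBump x₀ := fun j => ⟨j + 1, j + 2, by positivity, by linarith⟩
  let χ : ℕ → EuclideanSpace ℝ (Fin n) → ℝ := fun j x =>
    θ j x - if j = 0 then 0 else θ (j - 1) x
  have hχ : ∀ j, ContDiff ℝ ∞ (χ j) := by
    intro j
    refine (θ j).contDiff.sub ?_
    split_ifs
    · exact contDiff_const
    · exact (θ (j - 1)).contDiff
  have hχsum : ∀ N x, ∑ j ∈ Finset.range (N + 1), χ j x = θ N x := by
    intro N x
    induction N with
    | zero => simp [χ]
    | succ N ih =>
      rw [Finset.sum_range_succ, ih]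
      simp [χ]
  have hχ1 : ∀ j x, |χ j x| ≤ 1 := by
    intro j x
    have h1 : 0 ≤ θ j x := (θ j).nonneg
    have h2 : θ j x ≤ 1 := (θ j).le_one
    have h3 : 0 ≤ (if j = 0 then 0 else θ (j - 1) x) := by
      split_ifs
      · exact le_rfl
      · exact (θ (j - 1)).nonneg
    have h4 : (if j = 0 then 0 else θ (j - 1) x) ≤ 1 := by
      split_ifs
      · exact zero_le_one
      · exact (θ (j - 1)).le_one
    rw [abs_le]
    constructor <;> simp only [χ] <;> linarith
  have hχ0 : ∀ (j : ℕ) (x), x ∈ ball x₀ j → χ j x = 0 := by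
    intro j x hx
    rcases Nat.eq_zero_or_pos j with rfl | hj
    · simp at hx
    · have h1 : θ j x = 1 := (θ j).one_of_mem_closedBall
        (mem_closedBall.mpr ((mem_ball.mp hx).le.trans (by simp [θ])))
      have h2 : θ (j - 1) x = 1 := (θ (j - 1)).one_of_mem_closedBall
        (mem_closedBall.mpr ((mem_ball.mp hx).le.trans (by simp [θ, Nat.cast_pred hj])))
      simp [χ, h1, h2, hj.ne']
  have hχout : ∀ j, tsupport (χ j) ⊆ closedBall x₀ (j + 2) := by
    intro j
    refine closure_minimal (fun x hx => ?_) isClosed_closedBall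
    by_contra hxb
    rw [mem_closedBall, not_le] at hxb
    refine hx ?_
    have h1 : θ j x = 0 := (θ j).zero_of_le_dist hxb.le
    simp only [χ, h1]
    split_ifs with hj
    · simp
    · have h2 : θ (j - 1) x = 0 := (θ (j - 1)).zero_of_le_dist
        (le_trans (by simp [θ, Nat.cast_pred (Nat.pos_of_ne_zero hj)]) hxb.le)
      simp [h2]
  have hχc : ∀ j, HasCompactSupport (χ j) := fun j =>
    (isCompact_closedBall _ _).of_isClosed_subset (isClosed_tsupport _) (hχout j)
  have hM : ∀ j, ∃ M : ℝ, ∀ x, ‖fderiv ℝ (χ j) x‖ ≤ M := by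
    intro j
    exact ((hχ j).continuous_fderiv (by simp)).bounded_above_of_compact_support
      ((hχc j).fderiv ℝ)
  choose M hM using hM
  obtain ⟨ε', hε', hsum⟩ := ENNReal.exists_pos_sum_of_countable
    (ENNReal.ofReal_pos.mpr hε).ne' ℕ
  -- the denominator absorbs the derivative of `χ j` in the product rule
  have hη : ∀ j, 0 < (ε' j : ℝ≥0∞) / (1 + ENNReal.ofReal (M j)) := fun j =>
    ENNReal.div_pos (by simpa using (hε' j).ne') (by finiteness)
  choose w hw hwA hwN hwD using fun j : ℕ => hA (j + 2) (by positivity) _ (hη j)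
  have hle1 : ∀ j, (ε' j : ℝ≥0∞) / (1 + ENNReal.ofReal (M j)) ≤ ε' j := fun j =>
    ENNReal.div_le_of_le_mul (le_mul_of_one_le_right zero_le le_self_add)
  let v : ℕ → EuclideanSpace ℝ (Fin n) → ℝ := fun j x => χ j x * w j x
  have hv : ∀ j, ContDiff ℝ ∞ (v j) := fun j => (hχ j).mul (hw j)
  have hvN : ∀ j, eLpNorm (v j) (ENNReal.ofReal p) volume ≤ ε' j := by
    intro j
    rw [← eLpNorm_restrict_eq_of_support_subset (s := closedBall x₀ (j + 2))
      (((Function.support_mul_subset_left _ _).trans (subset_tsupport _)).trans (hχout j))]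
    refine (eLpNorm_mono fun x => ?_).trans ((hwN j).trans (hle1 j))
    rw [norm_mul]
    exact mul_le_of_le_one_left (norm_nonneg _) (hχ1 j x)
  have hvD : ∀ j, eLpNorm (fderiv ℝ (v j)) (ENNReal.ofReal p) volume ≤ ε' j := by
    intro j
    have h1 : fderiv ℝ (v j) = (fun x => χ j x • fderiv ℝ (w j) x) +
        fun x => w j x • fderiv ℝ (χ j) x := by
      ext x : 1
      exact fderiv_fun_mul ((hχ j).differentiable (by simp) x) ((hw j).differentiable (by simp) x)
    have hc1 : Continuous fun x => χ j x • fderiv ℝ (w j) x :=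
      (hχ j).continuous.smul ((hw j).continuous_fderiv (by simp))
    have hc2 : Continuous fun x => w j x • fderiv ℝ (χ j) x :=
      (hw j).continuous.smul ((hχ j).continuous_fderiv (by simp))
    have h2 : eLpNorm (fun x => χ j x • fderiv ℝ (w j) x) (ENNReal.ofReal p) volume ≤
        eLpNorm (fderiv ℝ (w j)) (ENNReal.ofReal p) volume := by
      refine eLpNorm_mono fun x => ?_
      rw [norm_smul]
      exact mul_le_of_le_one_left (norm_nonneg _) (hχ1 j x)
    have h3 : eLpNorm (fun x => w j x • fderiv ℝ (χ j) x) (ENNReal.ofReal p) volume ≤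
        ENNReal.ofReal (M j) *
          eLpNorm (w j) (ENNReal.ofReal p) (volume.restrict (closedBall x₀ (j + 2))) := by
      rw [← eLpNorm_restrict_eq_of_support_subset (s := closedBall x₀ (j + 2))
        (f := fun x => w j x • fderiv ℝ (χ j) x)
        (((Function.support_smul_subset_right (w j) (fderiv ℝ (χ j))).trans 
          (support_fderiv_subset ℝ)).trans (hχout j))]
      refine eLpNorm_le_mul_eLpNorm_of_ae_le_mul (ae_of_all _ fun x => ?_) _
      rw [norm_smul, mul_comm]
      gcongr
      exact hM j x
    rw [h1]
    calc _ ≤ _ := eLpNorm_add_le hc1.aestronglyMeasurable hc2.aestronglyMeasurable hp1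
      _ ≤ (ε' j : ℝ≥0∞) / (1 + ENNReal.ofReal (M j)) +
          ENNReal.ofReal (M j) * ((ε' j : ℝ≥0∞) / (1 + ENNReal.ofReal (M j))) :=
        add_le_add (h2.trans (hwD j)) (h3.trans (by gcongr; exact hwN j))
      _ = (1 + ENNReal.ofReal (M j)) * ((ε' j : ℝ≥0∞) / (1 + ENNReal.ofReal (M j))) := by
        rw [add_mul, one_mul]
      _ ≤ ε' j := ENNReal.mul_div_le
  let U : ℕ → EuclideanSpace ℝ (Fin n) → ℝ := fun N x => ∑ j ∈ Finset.range N, v j x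
  let u : EuclideanSpace ℝ (Fin n) → ℝ := fun x => ∑' j, v j x
  have hU : ∀ N, ContDiff ℝ ∞ (U N) := fun N => ContDiff.sum fun j _ => hv j
  -- on the ball of radius `N` only the first `N` terms are nonzero
  have huU : ∀ (N : ℕ) x, x ∈ ball x₀ N → u =ᶠ[𝓝 x] U N := by
    intro N x hx
    filter_upwards [isOpen_ball.mem_nhds hx] with y hy
    refine tsum_eq_sum fun j hj => ?_
    have hNj : N ≤ j := by simpa using hj
    simp only [v]
    rw [hχ0 j y (ball_subset_ball (by exact_mod_cast hNj) hy), zero_mul]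
  have hball : ∀ x, ∀ᶠ N : ℕ in atTop, x ∈ ball x₀ N := by
    intro x
    filter_upwards [tendsto_natCast_atTop_atTop.eventually_gt_atTop (dist x x₀)] with N hN
    exact hN
  have hu : ContDiff ℝ ∞ u := by
    rw [contDiff_iff_contDiffAt]
    intro x
    obtain ⟨N, hN⟩ := (hball x).exists
    exact (hU N).contDiffAt.congr_of_eventuallyEq (huU N x hN)
  have hUd : ∀ N, fderiv ℝ (U N) = ∑ j ∈ Finset.range N, fderiv ℝ (v j) := by
    intro N
    ext x : 1
    rw [Finset.sum_apply]
    exact fderiv_fun_sum fun j _ => (hv j).differentiable (by simp) x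
  have hpart : ∀ N, ∑ j ∈ Finset.range N, (ε' j : ℝ≥0∞) ≤ ENNReal.ofReal ε := fun N =>
    (ENNReal.sum_le_tsum _).trans hsum.le
  have huN : eLpNorm u (ENNReal.ofReal p) volume ≤ ENNReal.ofReal ε := by
    refine (Lp.eLpNorm_lim_le_liminf_eLpNorm (f := U)
      (fun N => (hU N).continuous.aestronglyMeasurable) u (ae_of_all _ fun x => ?_)).trans ?_
    · refine tendsto_const_nhds.congr' ?_
      filter_upwards [hball x] with N hN
      exact (huU N x hN).self_of_nhds
    · refine (liminf_le_liminf (v := fun _ => ENNReal.ofReal ε)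
        (Eventually.of_forall fun N => ?_)).trans (liminf_const _).le
      have h1 := eLpNorm_sum_le (s := Finset.range N) (f := v) (μ := volume)
        (fun j _ => (hv j).continuous.aestronglyMeasurable) hp1
      have h2 : U N = ∑ j ∈ Finset.range N, v j := by
        ext x
        simp [U]
      rw [h2]
      exact h1.trans ((Finset.sum_le_sum fun j _ => hvN j).trans (hpart N))
  have huD : eLpNorm (fderiv ℝ u) (ENNReal.ofReal p) volume ≤ ENNReal.ofReal ε := by
    refine (Lp.eLpNorm_lim_le_liminf_eLpNorm (f := fun N => fderiv ℝ (U N))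
      (fun N => ((hU N).continuous_fderiv (by simp)).aestronglyMeasurable) (fderiv ℝ u)
      (ae_of_all _ fun x => ?_)).trans ?_
    · refine tendsto_const_nhds.congr' ?_
      filter_upwards [hball x] with N hN
      exact (huU N x hN).fderiv_eq
    · refine (liminf_le_liminf (v := fun _ => ENNReal.ofReal ε)
        (Eventually.of_forall fun N => ?_)).trans (liminf_const _).le
      have h1 := eLpNorm_sum_le (s := Finset.range N) (f := fun j => fderiv ℝ (v j)) (μ := volume)
        (fun j _ => ((hv j).continuous_fderiv (by simp)).aestronglyMeasurable) hp1
      simp only [hUd]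
      exact h1.trans ((Finset.sum_le_sum fun j _ => hvD j).trans (hpart N))
  have hu1 : ∀ x ∈ A, ∀ᶠ y in 𝓝 x, 1 ≤ u y := by
    intro x hx
    obtain ⟨N, hxN, hN⟩ := ((hball x).and (eventually_ge_atTop 1)).exists
    have hall : ∀ᶠ y in 𝓝 x, ∀ j ∈ Finset.range N, w j y = 1 :=
      (Filter.eventually_all_finset _).mpr fun j _ => (hwA j).filter_mono (nhds_le_nhdsSet hx)
    filter_upwards [huU N x hxN, hall, isOpen_ball.mem_nhds hxN] with y h1 h2 h3
    have h4 : U N y = ∑ j ∈ Finset.range N, χ j y :=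
      Finset.sum_congr rfl fun j hj => by simp only [v]; rw [h2 j hj, mul_one]
    obtain ⟨m, rfl⟩ : ∃ m, N = m + 1 := ⟨N - 1, by omega⟩
    rw [h1, h4, hχsum, (θ m).one_of_mem_closedBall
      (mem_closedBall.mpr (by simpa [θ] using (mem_ball.mp h3).le))]
  have hgc : Continuous (gradient u) := continuous_gradient hu
  rw [← eLpNorm_gradient] at huD
  calc sobolevCapacity p A
      ≤ eLpNorm u (ENNReal.ofReal p) volume ^ p +
          eLpNorm (gradient u) (ENNReal.ofReal p) volume ^ p := by
        refine iInf_le_of_le u (iInf_le_of_le (gradient u) (iInf_le _ ⟨?_, ⟨?_, ?_⟩, ?_⟩))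
        · exact ⟨hu.continuous.aestronglyMeasurable, huN.trans_lt ENNReal.ofReal_lt_top⟩
        · exact isWeakGradient_gradient hu univ
        · rw [Measure.restrict_univ]
          exact ⟨hgc.aestronglyMeasurable, huD.trans_lt ENNReal.ofReal_lt_top⟩
        · refine ⟨{x | ∀ᶠ y in 𝓝 x, 1 ≤ u y}, isOpen_setOfPred_eventually_nhds, hu1, ?_⟩
          exact (ae_restrict_iff' isOpen_setOfPred_eventually_nhds.measurableSet).mpr
            (ae_of_all _ fun x hx => hx.self_of_nhds)
    _ ≤ ENNReal.ofReal ε ^ p + ENNReal.ofReal ε ^ p := by gcongr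
    _ = 2 * ENNReal.ofReal ε ^ p := (two_mul _).symm

/-! ### The capacitary distance -/

section

variable {n : ℕ} {p : ℝ} {Ω : Set (EuclideanSpace ℝ (Fin n))}

theorem exists_smoothAdmissible_of_capacitaryDist_lt (hp : 1 ≤ p) (hΩ : IsOpen Ω) {x y : Ω}
    {c : ℝ≥0∞} (h : capacitaryDist p Ω x y < c) :
    ∃ (γ : Path x y) (φ : EuclideanSpace ℝ (Fin n) → ℝ),
      SmoothAdmissible (Subtype.val '' range γ) Ω φ ∧
        eLpNorm (fderiv ℝ φ) (ENNReal.ofReal p) volume < c := by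
  obtain ⟨γ, hγ⟩ := iInf_lt_iff.mp h
  exact ⟨γ, exists_smoothAdmissible_of_condenserCapacity_lt hp hΩ hγ⟩

theorem SmoothAdmissible.capacitaryDist_le (hp : 1 ≤ p) {x y : Ω} {γ : Path x y}
    {φ : EuclideanSpace ℝ (Fin n) → ℝ} (h : SmoothAdmissible (Subtype.val '' range γ) Ω φ) :
    capacitaryDist p Ω x y ≤ eLpNorm (fderiv ℝ φ) (ENNReal.ofReal p) volume :=
  iInf_le_of_le γ (h.condenserCapacity_rpow_le hp)

theorem capacitaryDist_lt_top (hp : 1 ≤ p) (hΩo : IsOpen Ω) (hΩc : IsConnected Ω) (x y : Ω) :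
    capacitaryDist p Ω x y < ⊤ := by
  have hpc : PathConnectedSpace Ω :=
    isPathConnected_iff_pathConnectedSpace.mp (hΩo.isConnected_iff_isPathConnected.mp hΩc)
  obtain ⟨γ⟩ : Nonempty (Path x y) := hpc.joined x y
  have hK : IsCompact (Subtype.val '' range γ) :=
    (isCompact_range γ.continuous).image continuous_subtype_val
  obtain ⟨φ, hφ⟩ := hK.exists_smoothAdmissible hΩo (Subtype.coe_image_subset _ _)
  exact (hφ.capacitaryDist_le hp).trans_lt (hφ.eLpNorm_fderiv_lt_top _ _)

theorem capacitaryDist_self (hn : 2 ≤ n) (hp : 1 ≤ p) (hpn : p ≤ n) (hΩ : IsOpen Ω) (x : Ω) :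
    capacitaryDist p Ω x x = 0 := by
  by_contra hne
  have hd : Module.finrank ℝ (EuclideanSpace ℝ (Fin n)) = n := by simp
  obtain ⟨φ, hφ, hlt⟩ := exists_smoothAdmissible_singleton_eLpNorm_lt volume (by rwa [hd]) hp
    (by rwa [hd]) hΩ x.2 (pos_iff_ne_zero.mpr hne)
  have himg : Subtype.val '' range (Path.refl x) = {x.1} := by simp
  exact absurd hlt (not_lt.mpr (SmoothAdmissible.capacitaryDist_le hp (himg ▸ hφ)))

theorem capacitaryDist_comm (x y : Ω) : capacitaryDist p Ω x y = capacitaryDist p Ω y x := by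
  have h : ∀ x y : Ω, capacitaryDist p Ω x y ≤ capacitaryDist p Ω y x := fun x y =>
    le_iInf fun γ => iInf_le_of_le γ.symm (by rw [Path.symm_range])
  exact le_antisymm (h x y) (h y x)

theorem capacitaryDist_triangle (hp : 1 ≤ p) (hΩ : IsOpen Ω) (x y z : Ω) :
    capacitaryDist p Ω x z ≤ capacitaryDist p Ω x y + capacitaryDist p Ω y z := by
  refine ENNReal.le_of_forall_pos_le_add fun ε hε hfin => ?_
  have hε2 : (0 : ℝ≥0∞) < ε / 2 := ENNReal.half_pos (by simpa using hε.ne')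
  have hne := ENNReal.add_lt_top.mp hfin
  obtain ⟨γ₁, φ₁, h₁, hlt₁⟩ := exists_smoothAdmissible_of_capacitaryDist_lt hp hΩ
    (ENNReal.lt_add_right hne.1.ne hε2.ne')
  obtain ⟨γ₂, φ₂, h₂, hlt₂⟩ := exists_smoothAdmissible_of_capacitaryDist_lt hp hΩ
    (ENNReal.lt_add_right hne.2.ne hε2.ne')
  have hadm : SmoothAdmissible (Subtype.val '' range (γ₁.trans γ₂)) Ω (φ₁ + φ₂) := by
    refine ⟨h₁.contDiff.add h₂.contDiff, h₁.hasCompactSupport.add h₂.hasCompactSupport,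
      (tsupport_add _ _).trans (union_subset h₁.tsupport_subset h₂.tsupport_subset),
      fun a => add_nonneg (h₁.nonneg a) (h₂.nonneg a), fun a ha => ?_⟩
    rw [Path.trans_range, image_union] at ha
    have n₁ := h₁.nonneg a
    have n₂ := h₂.nonneg a
    rw [Pi.add_apply]
    rcases ha with ha | ha
    · linarith [h₁.one_le a ha]
    · linarith [h₂.one_le a ha]
  have hfd : fderiv ℝ (φ₁ + φ₂) = fderiv ℝ φ₁ + fderiv ℝ φ₂ := by
    ext a : 1
    exact fderiv_add (h₁.contDiff.differentiable (by simp) a)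
      (h₂.contDiff.differentiable (by simp) a)
  calc capacitaryDist p Ω x z ≤ eLpNorm (fderiv ℝ (φ₁ + φ₂)) (ENNReal.ofReal p) volume :=
        hadm.capacitaryDist_le hp
    _ ≤ eLpNorm (fderiv ℝ φ₁) (ENNReal.ofReal p) volume +
          eLpNorm (fderiv ℝ φ₂) (ENNReal.ofReal p) volume := by
        rw [hfd]
        exact eLpNorm_add_le (f := fderiv ℝ φ₁) (g := fderiv ℝ φ₂)
          (h₁.contDiff.continuous_fderiv (by simp)).aestronglyMeasurable
          (h₂.contDiff.continuous_fderiv (by simp)).aestronglyMeasurable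
          (ENNReal.one_le_ofReal.mpr hp)
    _ ≤ (capacitaryDist p Ω x y + ε / 2) + (capacitaryDist p Ω y z + ε / 2) :=
        add_le_add hlt₁.le hlt₂.le
    _ = capacitaryDist p Ω x y + capacitaryDist p Ω y z + ε := by
        rw [add_add_add_comm, ENNReal.add_halves]

theorem isPreconnected_image_range_path {x y : Ω} (γ : Path x y) :
    IsPreconnected (Subtype.val '' range γ) :=
  (isPreconnected_range γ.continuous).image _ continuous_subtype_val.continuousOn

/-- In the range `p > n - 1`, vanishing of the distance of two distinct points forces the boundary
to have zero capacity: admissible functions of small energy are close to a nonzero constant on large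
balls, although they vanish near the boundary. -/
theorem sobolevCapacity_frontier_eq_zero (hp : 1 ≤ p) (hnp : (n : ℝ) - 1 < p) (hΩ : IsOpen Ω)
    {x y : Ω} (hxy : x ≠ y) (h : capacitaryDist p Ω x y = 0) :
    sobolevCapacity p (frontier Ω) = 0 := by
  refine sobolevCapacity_eq_zero_of_forall_exists hp x.1 fun R hR η hη => ?_
  have hη2 : 0 < η / 2 := ENNReal.half_pos hη.ne'
  have hδ : 0 < dist y.1 x.1 := dist_pos.mpr fun he => hxy (Subtype.ext he.symm)
  obtain ⟨ε, hε, hmain⟩ := exists_eLpNorm_sub_const_le (E := EuclideanSpace ℝ (Fin n)) volume hp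
    (by simpa using hnp) hR hδ hη2
  obtain ⟨γ, f, hf, hlt⟩ := exists_smoothAdmissible_of_capacitaryDist_lt hp hΩ
    (x := x) (y := y) (c := min ε (η / 2)) (by rw [h]; exact lt_min hε hη2)
  obtain ⟨a, ha, hfa⟩ := hmain f hf.contDiff _ (isPreconnected_image_range_path γ) hf.one_le x.1
    ⟨x, ⟨0, γ.source⟩, rfl⟩ y.1 ⟨y, ⟨1, γ.target⟩, rfl⟩ le_rfl (hlt.trans_le (min_le_left _ _))
  have ha0 : 0 < a := by linarith
  have hs : ‖-a⁻¹‖ₑ ≤ 2 := by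
    rw [enorm_neg, Real.enorm_eq_ofReal (inv_pos.mpr ha0).le, ← ENNReal.ofReal_ofNat 2]
    refine ENNReal.ofReal_le_ofReal ?_
    rw [inv_le_comm₀ ha0 two_pos]
    linarith
  have hw : (fun z => 1 - a⁻¹ * f z) = (-a⁻¹) • fun z => f z - a := by
    ext z
    simp only [Pi.smul_apply, smul_eq_mul]
    field_simp
    ring
  have hwd : fderiv ℝ (fun z => 1 - a⁻¹ * f z) = (-a⁻¹) • fderiv ℝ f := by
    ext z : 1
    have h1 := ((((hf.contDiff.differentiable (by simp)) z).hasFDerivAt.const_mul a⁻¹).const_sub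
      1).fderiv
    rw [h1, Pi.smul_apply, neg_smul]
  refine ⟨fun z => 1 - a⁻¹ * f z, contDiff_const.sub (contDiff_const.mul hf.contDiff), ?_, ?_, ?_⟩
  · have hsub : frontier Ω ⊆ (tsupport f)ᶜ := fun z hz hzf =>
      (hΩ.frontier_eq ▸ hz).2 (hf.tsupport_subset hzf)
    filter_upwards [(isClosed_tsupport f).isOpen_compl.mem_nhdsSet.mpr hsub] with z hz
    rw [image_eq_zero_of_notMem_tsupport hz, mul_zero, sub_zero]
  · rw [hw, eLpNorm_const_smul]
    calc _ ≤ 2 * (η / 2) := mul_le_mul' hs hfa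
      _ = η := ENNReal.mul_div_cancel two_ne_zero (by simp)
  · rw [hwd, eLpNorm_const_smul (c := -a⁻¹) (f := fderiv ℝ f)]
    calc _ ≤ 2 * (η / 2) := mul_le_mul' hs (hlt.le.trans (min_le_right _ _))
      _ = η := ENNReal.mul_div_cancel two_ne_zero (by simp)

end

theorem eq_of_capacitaryDist_one_eq_zero {Ω : Set (EuclideanSpace ℝ (Fin 2))} (hΩ : IsOpen Ω)
    {x y : Ω} (h : capacitaryDist 1 Ω x y = 0) : x = y := by
  refine Subtype.ext (PiLp.ext fun i => ?_)
  by_contra hne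
  have hpos : 0 < ENNReal.ofReal |y.1 i - x.1 i| :=
    ENNReal.ofReal_pos.mpr (abs_pos.mpr (sub_ne_zero.mpr (Ne.symm hne)))
  obtain ⟨γ, f, hf, hlt⟩ := exists_smoothAdmissible_of_capacitaryDist_lt le_rfl hΩ
    (x := x) (y := y) (by rw [h]; exact hpos)
  rw [ENNReal.ofReal_one] at hlt
  exact absurd hlt (not_lt.mpr (ofReal_abs_sub_le_eLpNorm_one_fderiv hf.contDiff
    hf.hasCompactSupport (isPreconnected_image_range_path γ) hf.one_le
    ⟨x, ⟨0, γ.source⟩, rfl⟩ ⟨y, ⟨1, γ.target⟩, rfl⟩ i))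

theorem mainTheorem5 (n : ℕ) (hn : 2 ≤ n) (p : ℝ)
    (hp : (n : ℝ) - 1 < p ∨ (n = 2 ∧ 1 ≤ p)) (hpn : p ≤ n)
    (Ω : Set (EuclideanSpace ℝ (Fin n))) (hΩo : IsOpen Ω) (hΩc : IsConnected Ω)
    (hcap : 0 < sobolevCapacity p (frontier Ω)) :
    ∃ m : MetricSpace Ω, ∀ x y : Ω, ENNReal.ofReal (m.dist x y) = capacitaryDist p Ω x y := by
  have hn' : (2 : ℝ) ≤ n := by exact_mod_cast hn
  have hp1 : 1 ≤ p := by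
    rcases hp with h | h
    · linarith
    · exact h.2
  have hfin : ∀ x y : Ω, capacitaryDist p Ω x y ≠ ⊤ := fun x y =>
    (capacitaryDist_lt_top hp1 hΩo hΩc x y).ne
  have hzero : ∀ x y : Ω, capacitaryDist p Ω x y = 0 → x = y := by
    intro x y h
    by_cases hnp : (n : ℝ) - 1 < p
    · by_contra hxy
      exact hcap.ne' (sobolevCapacity_frontier_eq_zero hp1 hnp hΩo hxy h)
    · obtain ⟨rfl, -⟩ := hp.resolve_left hnp
      obtain rfl : p = 1 := by
        push_cast at hnp
        linarith
      exact eq_of_capacitaryDist_one_eq_zero hΩo h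
  exact ⟨{
    dist := fun x y => (capacitaryDist p Ω x y).toReal
    dist_self := fun x => by simp [capacitaryDist_self hn hp1 hpn hΩo x]
    dist_comm := fun x y => by rw [capacitaryDist_comm]
    dist_triangle := fun x y z => by
      rw [← ENNReal.toReal_add (hfin x y) (hfin y z)]
      exact ENNReal.toReal_mono (ENNReal.add_ne_top.mpr ⟨hfin x y, hfin y z⟩)
        (capacitaryDist_triangle hp1 hΩo x y z)
    eq_of_dist_eq_zero := fun {x y} h =>
      hzero x y ((ENNReal.toReal_eq_zero_iff _).mp h |>.resolve_right (hfin x y)) },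
    fun x y => ENNReal.ofReal_toReal (hfin x y)⟩
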